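/- **Theorem (multipartite CLT for the log-partition function).** Fix $\ell\ge 2$ and a set $A$ of unordered pairs $\{s,t\}$, $1\le s\le t\le \ell$, of blocks ($s=t$ is allowed). For $n\in\mathbb N$ let $G_n$ be the graph whose vertex set is the disjoint union of blocks of sizes $N_{n,1},\dots,N_{n,\ell}$ and in which a vertex of block $s$ and a different vertex of block $t$ are adjacent exactly when $\{s,t\}\in A$. ($A=\{s<t\}$ gives the complete $\ell$-partite graph; for $A=\{s\le t\}$ the edges inside the blocks are present as well.) Assume $|V(G_n)|=\sum_i N_{n,i}\to\infty$ and $N_{n,i}/|V(G_n)|\to\lambda_i>0$ for every $i$. For $\{s,t\}\in A$ let $E_{s,t}$ be the set of edges between blocks $s$ and $t$. All sums over $s\le t$ below run over $\{s,t\}\in A$. Let $\mathcal S_n$ be a family of sets of edges of $G_n$ and let $\mathbb P_\pi$ denote the probability for $\pi$ uniform in $\mathcal S_n$. A *partial matching* is a set of pairwise vertex-disjoint edges. Assume that, for all $n$: 1. every $\pi\in\mathcal S_n$ has $|\pi\cap E_{s,t}|=m_{s,t}=m_{s,t}(n)$ edges in $E_{s,t}$ for each $\{s,t\}\in A$, and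 $\lim_{n\to\infty} m_{s,t}^2/(2|E_{s,t}|)=\gamma_{s,t}\in(0,\infty)$; put $m=\sum_{s\le t}m_{s,t}$; 2. $\mathbb P_\pi(e\in\pi)$ takes the same value for all $e\in E_{s,t}$ (so that it equals $m_{s,t}/|E_{s,t}|$); 3. every partial matching is contained in some $\pi\in\mathcal S_n$; 4. there is $\rho\in(0,\infty)$, independent of $n$, with $\Big|\frac{\mathbb P_\pi(\Gamma\subseteq\pi)}{\prod_{e\in\Gamma}\mathbb P_\pi(e\in\pi)}-1\Big|\le \rho^{|\Gamma|}/\sqrt m$ for every partial matching $\Gamma$; 5. there is $\rho\in(0,\infty)$, independent of $n$, with $\mathbb P_\pi(\Gamma\subseteq\pi)\le\rho^{|\Gamma|}\prod_{e\in\Gamma}\mathbb P_\pi(e\in\pi)$ for every $\Gamma$ that is contained in some $\pi\in\mathcal S_n$ and is not a partial matching. Let the weights $(\omega_e)_{e\in E(G_n)}$ be independent random variables with values in $(-\infty,\infty]$, where the law of $\omega_e$ for $e\in E_{s,t}$ depends only on $\{s,t\}$ (and not on $n$), and write $\omega_{s,t}$ for a variable with this law. Assume that $\psi_{s,t}(b):=\log\mathbb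 E e^{-b\,\omega_{s,t}}$ is finite for all $b>0$ (with $e^{-\infty}=0$), and put $v_b^2(s,t):=\exp(\psi_{s,t}(2b)-2\psi_{s,t}(b))-1$. Fix $\beta\in(0,\infty)$ and let $$Z_n(\beta)=\frac1{|\mathcal S_n|}\sum_{\pi\in\mathcal S_n}\exp\Big(-\beta\sum_{e\in\pi}\omega_e\Big).$$ Then $\mathbb P(Z_n(\beta)=0)\to0$ and, with any real value assigned to $\log Z_n(\beta)$ on $\{Z_n(\beta)=0\}$, as $n\to\infty$, $$\log Z_n(\beta)-\sum_{s\le t}m_{s,t}\,\psi_{s,t}(\beta)\;\Longrightarrow\; N\Big(-\sum_{s\le t}\gamma_{s,t}v_\beta^2(s,t),\;2\sum_{s\le t}\gamma_{s,t}v_\beta^2(s,t)\Big)$$ in distribution, where $N(0,0)$ is the point mass at $0$. -/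

import Mathlib

open Filter Topology MeasureTheory ProbabilityTheory
open scoped ENNReal NNReal

namespace BlockCLT

/-- The vertices of a graph with `ℓ` blocks, the `i`-th block having `N i` vertices. -/
abbrev Vertex {ℓ : ℕ} (N : Fin ℓ → ℕ) : Type := Σ i : Fin ℓ, Fin (N i)

/-- The graph in which two distinct vertices `x`, `y` are adjacent exactly when the unordered pair
`{s, t}` of their blocks (possibly with `s = t`) belongs to `A`. If `A` is the set of all pairs
with `s ≠ t`, this is the complete `ℓ`-partite graph; if `A` is the set of all pairs `s ≤ t`, the
blocks are filled as well. -/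
def blockGraph {ℓ : ℕ} (A : Finset (Sym2 (Fin ℓ))) (N : Fin ℓ → ℕ) : SimpleGraph (Vertex N) where
  Adj x y := x ≠ y ∧ s(x.1, y.1) ∈ A
  symm := ⟨fun x y h => ⟨h.1.symm, by rw [Sym2.eq_swap]; exact h.2⟩⟩
  loopless := ⟨fun _ h => h.1 rfl⟩

/-- The type of edges of `blockGraph A N`. -/
abbrev Edge {ℓ : ℕ} (A : Finset (Sym2 (Fin ℓ))) (N : Fin ℓ → ℕ) : Type :=
  {e : Sym2 (Vertex N) // e ∈ (blockGraph A N).edgeSet}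

section

variable {ℓ : ℕ} {A : Finset (Sym2 (Fin ℓ))} {N : Fin ℓ → ℕ}

/-- The unordered pair of blocks that an edge joins. -/
def blocks (e : Edge A N) : Sym2 (Fin ℓ) := e.1.map Sigma.fst

/-- `E_{s,t}`: the set of edges between the two blocks of the pair `q = {s, t}`. -/
def blockEdges (A : Finset (Sym2 (Fin ℓ))) (N : Fin ℓ → ℕ) (q : Sym2 (Fin ℓ)) : Set (Edge A N) :=
  {e | blocks e = q}

/-- A partial matching: a set of pairwise vertex-disjoint edges. -/
def IsPartialMatching (Γ : Finset (Edge A N)) : Prop :=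
  ∀ e ∈ Γ, ∀ f ∈ Γ, e ≠ f → ∀ v, ¬ (v ∈ e.1 ∧ v ∈ f.1)

/-- `ℙ_π(Γ ⊆ π)` for `π` chosen uniformly at random from the family `S` of configurations. -/
noncomputable def inclProb (S : Finset (Finset (Edge A N))) (Γ : Finset (Edge A N)) : ℝ :=
  ((S.filter (fun π => Γ ⊆ π)).card : ℝ) / (S.card : ℝ)

/-- The total weight `W(π) = ∑_{e ∈ π} ω_e`. Weights are extended reals. -/
noncomputable def totalWeight (w : Edge A N → EReal) (π : Finset (Edge A N)) : EReal :=
  ∑ e ∈ π, w e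

/-- The partition function `Z(β) = |S|⁻¹ ∑_{π ∈ S} exp (-β W(π))`, with `exp (-∞) = 0`. -/
noncomputable def partitionFn (S : Finset (Finset (Edge A N))) (w : Edge A N → EReal) (β : ℝ) :
    ℝ≥0∞ :=
  (S.card : ℝ≥0∞)⁻¹ * ∑ π ∈ S, EReal.exp (-((β : EReal) * totalWeight w π))

end

/-- `𝔼 exp (-β ω)` for a weight `ω` with law `μ`. -/
noncomputable def laplace (μ : Measure EReal) (β : ℝ) : ℝ≥0∞ :=
  ∫⁻ x, EReal.exp (-((β : EReal) * x)) ∂μ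

/-- `ψ(β) = log 𝔼 exp (-β ω)`; meaningful when `0 < 𝔼 exp (-β ω) < ∞`. -/
noncomputable def psi (μ : Measure EReal) (β : ℝ) : ℝ := Real.log (laplace μ β).toReal

/-- `v_β² = exp (ψ(2β) - 2ψ(β)) - 1`; it is nonnegative by the Cauchy-Schwarz inequality. -/
noncomputable def vSq (μ : Measure EReal) (β : ℝ) : ℝ :=
  Real.exp (psi μ (2 * β) - 2 * psi μ β) - 1

end BlockCLT

namespace BlockCLT

/-! ### Analytic preliminaries -/

/-! Write `X_e` for the Boltzmann factor of the edge `e` divided by its mean, minus one. These are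
independent and centred, with second moment `v_β²` of their block pair. Since every configuration
has the same edge counts, `Z` is the constant `exp (∑ m ψ)` times the average `W` of `∏_{e ∈ π} (1 +
X_e)`. Expanding gives `W = ∑_Γ ℙ(Γ ⊆ π) ∏_{e ∈ Γ} X_e` (`toReal_partitionFn_eq_exp_mul`). If edges
entered `π` independently with probabilities `p_e = m / |E|`, the coefficients would be `∏_{e ∈ Γ}
p_e`, and the sum would be the product `∏_e (1 + p_e X_e)`, whose logarithm `L` is a sum of
independent terms.

The two sums are close in mean square. The monomials `∏_{e ∈ Γ} X_e` are orthogonal, so the squared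
distance is `∑_Γ (ℙ(Γ ⊆ π) - ∏ p_e)² ∏ v_e²` (`integrable_and_integral_sq_sub_prod`). Partial
matchings contribute `O(1/m)`. Any other `Γ` contains two edges with a common vertex, and summing
over such pairs costs a factor of order `V p² = O(V / |E|)`, which tends to zero because `|E|` is of
order `V²` (`sum_sq_inclProb_sub_prod_le`, `exists_eventually_mul_sq_le_ncard`).

The characteristic function of `log (1 + p X)` is `𝔼 (1 + p X)^{it} = 1 + it(it - 1)/2 · p² v² +
O(p³)`; the third moment is finite because the Laplace transform is finite at `3β`. As `|E| p² →
2γ`, the product over all edges tends to `exp (it(it - 1) ∑ γ v²)`, which is Gaussian with mean `-∑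
γ v²` and variance `2 ∑ γ v²` (`tendsto_charFun_sum_log_one_add`). Tightness of `L` turns closeness
of `W` and `exp L` into closeness of `log W` and `L` (`tendsto_measure_nonpos_or_le_abs_log_sub`),
and a Slutsky argument finishes. -/

/-- Mean value inequality on the segment from `0` to `x`, where `|y| ≤ |x|`. Each application gains
one power of `|x|`, so iterating it from a bounded third derivative yields a cubic Taylor remainder.
-/
lemma norm_le_mul_abs_pow_succ {g g' : ℝ → ℂ} {K : ℝ} {k : ℕ} (hK : 0 ≤ K) {s : Set ℝ}
    (hs : Convex ℝ s) (h0s : 0 ∈ s)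
    (hg : ∀ x ∈ s, HasDerivAt g (g' x) x) (h0 : g 0 = 0)
    (hb : ∀ x ∈ s, ‖g' x‖ ≤ K * |x| ^ k) {x : ℝ} (hx : x ∈ s) : ‖g x‖ ≤ K * |x| ^ (k + 1) := by
  have hsub : segment ℝ 0 x ⊆ s := hs.segment_subset h0s hx
  have := Convex.norm_image_sub_le_of_norm_hasDerivWithin_le (f := g) (f' := g')
    (C := K * |x| ^ k) (s := segment ℝ 0 x) (x := 0) (y := x)
    (fun y hy => (hg y (hsub hy)).hasDerivWithinAt) ?_ (convex_segment _ _)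
    (left_mem_segment _ _ _) (right_mem_segment _ _ _)
  · simpa [h0, pow_succ, mul_assoc] using this
  · intro y hy
    refine (hb y (hsub hy)).trans ?_
    have : |y| ≤ |x| := by
      rw [segment_eq_uIcc] at hy
      simpa using Set.abs_sub_left_of_mem_uIcc hy
    gcongr

lemma hasDerivAt_one_add_cpow (a : ℂ) {u : ℝ} (hu : -(1 / 2) ≤ u) :
    HasDerivAt (fun u : ℝ => ((1 + u : ℝ) : ℂ) ^ a) (a * ((1 + u : ℝ) : ℂ) ^ (a - 1)) u := by
  have h1 : HasDerivAt (fun z : ℂ => 1 + z) 1 (u : ℂ) := (hasDerivAt_id _).const_add 1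
  have h2 := (h1.cpow_const (c := a) (Or.inl (by simp; linarith))).comp_ofReal
  simpa using h2

/-- The imaginary part of the exponent contributes modulus one, leaving `(1 + u)⁻ᵏ` with `1 + u ≥
1/2`. -/
lemma norm_one_add_cpow_le (t : ℝ) (k : ℕ) {u : ℝ} (hu : -(1 / 2) ≤ u) :
    ‖((1 + u : ℝ) : ℂ) ^ ((t : ℂ) * Complex.I - k)‖ ≤ 2 ^ k := by
  rw [Complex.norm_cpow_eq_rpow_re_of_pos (by linarith)]
  simp only [Complex.sub_re, Complex.mul_re, Complex.ofReal_re, Complex.I_re, mul_zero,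
    Complex.ofReal_im, Complex.I_im, mul_one, sub_self, Complex.natCast_re, zero_sub]
  rw [Real.rpow_neg (by linarith), Real.rpow_natCast, ← inv_pow]
  gcongr
  · linarith [inv_nonneg.mpr (show 0 ≤ 1 + u by linarith)]
  rw [inv_le_comm₀ (by linarith) (by norm_num)]
  linarith

/-- Second-order expansion of `(1 + u) ^ (i t)` at `u = 0`, uniformly on `[-1/2, ∞)`. -/
lemma exists_norm_one_add_cpow_sub_le (t : ℝ) : ∃ C : ℝ, 0 ≤ C ∧ ∀ u : ℝ, -(1 / 2) ≤ u →
    ‖((1 + u : ℝ) : ℂ) ^ ((t : ℂ) * Complex.I) - 1 - (t : ℂ) * Complex.I * u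
      - (t : ℂ) * Complex.I * ((t : ℂ) * Complex.I - 1) / 2 * (u : ℂ) ^ 2‖ ≤ C * |u| ^ 3 := by
  set a : ℂ := (t : ℂ) * Complex.I with ha
  have hK : 0 ≤ ‖a * (a - 1) * (a - 2)‖ * 8 := by positivity
  refine ⟨_, hK, fun u hu => ?_⟩
  have hsub : ∀ u : ℝ, HasDerivAt (fun u : ℝ => (u : ℂ)) 1 u := fun u => by
    simpa using (hasDerivAt_id u).ofReal_comp
  have hs : Convex ℝ (Set.Ici (-(1 / 2) : ℝ)) := convex_Ici _
  have h0s : (0 : ℝ) ∈ Set.Ici (-(1 / 2) : ℝ) := by simp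
  -- `s3`, `s2`, `s1` bound the third, second and first derivatives of the remainder; the constant
  -- `8` is `2 ^ 3`.
  have s3 : ∀ x ∈ Set.Ici (-(1 / 2) : ℝ),
      ‖a * (a - 1) * (a - 2) * ((1 + x : ℝ) : ℂ) ^ (a - 3)‖
        ≤ ‖a * (a - 1) * (a - 2)‖ * 8 * |x| ^ 0 := by
    intro x hx
    rw [norm_mul, pow_zero, mul_one]
    have := norm_one_add_cpow_le t 3 (u := x) hx
    gcongr
    norm_num at this ⊢
    exact this
  have s2 : ∀ x ∈ Set.Ici (-(1 / 2) : ℝ),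
      ‖a * (a - 1) * ((1 + x : ℝ) : ℂ) ^ (a - 2) - a * (a - 1)‖
        ≤ ‖a * (a - 1) * (a - 2)‖ * 8 * |x| ^ 1 := by
    intro x hx
    refine norm_le_mul_abs_pow_succ (g := fun x : ℝ =>
      a * (a - 1) * ((1 + x : ℝ) : ℂ) ^ (a - 2) - a * (a - 1)) hK hs h0s ?_ (by simp) s3 hx
    intro x hx
    exact (((hasDerivAt_one_add_cpow (a - 2) hx).const_mul (a * (a - 1))).sub_const
      (a * (a - 1))).congr_deriv (by ring_nf)
  have s1 : ∀ x ∈ Set.Ici (-(1 / 2) : ℝ),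
      ‖a * ((1 + x : ℝ) : ℂ) ^ (a - 1) - a - a * (a - 1) * x‖
        ≤ ‖a * (a - 1) * (a - 2)‖ * 8 * |x| ^ 2 := by
    intro x hx
    refine norm_le_mul_abs_pow_succ (g := fun x : ℝ =>
      a * ((1 + x : ℝ) : ℂ) ^ (a - 1) - a - a * (a - 1) * x) hK hs h0s ?_ (by simp) s2 hx
    intro x hx
    exact ((((hasDerivAt_one_add_cpow (a - 1) hx).const_mul a).sub_const a).sub
      ((hsub x).const_mul (a * (a - 1)))).congr_deriv (by ring_nf)
  refine norm_le_mul_abs_pow_succ (g := fun u : ℝ =>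
      ((1 + u : ℝ) : ℂ) ^ a - 1 - a * u - a * (a - 1) / 2 * (u : ℂ) ^ 2) hK hs h0s ?_
      (by simp) s1 hu
  intro x hx
  exact ((((hasDerivAt_one_add_cpow a hx).sub_const 1).sub ((hsub x).const_mul a)).sub
      (((hsub x).pow 2).const_mul (a * (a - 1) / 2))).congr_deriv (by push_cast; ring_nf)

/-- Here `log (1 + z) = z + O(z²)`, and `K z² = (K z) z` tends to zero; `K` itself need not diverge.
-/
lemma tendsto_one_add_pow_exp {ι : Type*} {l : Filter ι} {K : ι → ℕ} {z : ι → ℂ} {c : ℂ}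
    (hz : Tendsto z l (𝓝 0)) (hK : Tendsto (fun n => (K n : ℂ) * z n) l (𝓝 c)) :
    Tendsto (fun n => (1 + z n) ^ K n) l (𝓝 (Complex.exp c)) := by
  have hO : (fun n => (K n : ℂ) * (Complex.log (1 + z n) - z n)) =O[l]
      fun n => (K n : ℂ) * z n ^ 2 :=
    (Asymptotics.isBigO_refl _ _).mul (Complex.log_sub_self_isBigO.comp_tendsto hz)
  have h0 : Tendsto (fun n => (K n : ℂ) * z n ^ 2) l (𝓝 0) := by
    have := hK.mul hz
    rw [mul_zero] at this
    exact this.congr fun n => by ring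
  have h1 := (hO.trans_tendsto h0).add hK
  rw [zero_add] at h1
  refine ((Complex.continuous_exp.tendsto c).comp h1).congr' ?_
  filter_upwards [hz.eventually_ne (show (0 : ℂ) ≠ -1 by simp)] with n hn
  have hne : 1 + z n ≠ 0 := fun h => hn (eq_neg_of_add_eq_zero_right h)
  simp only [Function.comp_apply]
  rw [show (K n : ℂ) * (Complex.log (1 + z n) - z n) + K n * z n
    = K n * Complex.log (1 + z n) by ring, Complex.exp_nat_mul, Complex.exp_log hne]

/-! ### Orthogonality of products of independent centred variables -/

section Orthogonal

variable {E Ω : Type*} [Fintype E] {mΩ : MeasurableSpace Ω} {P : Measure Ω}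
  [IsProbabilityMeasure P] {X : E → Ω → ℝ}

lemma integrable_fun_prod_comp_of_iIndepFun (hX : iIndepFun X P) (mX : ∀ e, AEMeasurable (X e) P)
    {f : E → ℝ → ℝ} (hf : ∀ e, Integrable (f e) (P.map (X e))) :
    Integrable (fun ω => ∏ e, f e (X e ω)) P := by
  have : ∀ e, IsProbabilityMeasure (P.map (X e)) := fun e =>
    Measure.isProbabilityMeasure_map (mX e)
  have h : Integrable (fun x : E → ℝ => ∏ e, f e (x e)) (P.map (fun ω e => X e ω)) := by
    rw [hX.map_fun_eq_pi_map mX]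
    exact Integrable.fintype_prod hf
  exact h.comp_aemeasurable (aemeasurable_pi_lambda _ mX)

variable [DecidableEq E]

/-- One factor per element of `E` is the form to which independence applies. No coordinate enters to
a power above two, so second moments suffice. -/
lemma prod_mul_prod_eq_prod_univ (Γ Δ : Finset E) (x : E → ℝ) :
    (∏ e ∈ Γ, x e) * ∏ e ∈ Δ, x e
      = ∏ e, ((if e ∈ Γ then x e else 1) * (if e ∈ Δ then x e else 1)) := by
  rw [Finset.prod_mul_distrib, Finset.prod_ite_mem, Finset.prod_ite_mem, Finset.univ_inter,
    Finset.univ_inter]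

variable (hX : iIndepFun X P) (h2 : ∀ e, MemLp (X e) 2 P)

include hX h2 in
lemma integrable_prod_mul_prod (Γ Δ : Finset E) :
    Integrable (fun ω => (∏ e ∈ Γ, X e ω) * ∏ e ∈ Δ, X e ω) P := by
  simp_rw [prod_mul_prod_eq_prod_univ]
  refine integrable_fun_prod_comp_of_iIndepFun (f := fun e x =>
    (if e ∈ Γ then x else 1) * (if e ∈ Δ then x else 1)) hX
    (fun e => (h2 e).aestronglyMeasurable.aemeasurable) fun e => ?_
  rw [integrable_map_measure (by split_ifs <;> fun_prop)
    (h2 e).aestronglyMeasurable.aemeasurable]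
  have h1 := (h2 e).integrable one_le_two
  have h3 : Integrable (fun ω => X e ω * X e ω) P := by simpa [sq] using (h2 e).integrable_sq
  split_ifs <;> simp [Function.comp_def, h1, h3]

include hX h2 in
-- If `Γ ≠ Δ`, some element lies in exactly one of them, and its factor has mean zero.
lemma integral_prod_mul_prod (h0 : ∀ e, ∫ ω, X e ω ∂P = 0) (Γ Δ : Finset E) :
    ∫ ω, (∏ e ∈ Γ, X e ω) * ∏ e ∈ Δ, X e ω ∂P
      = if Γ = Δ then ∏ e ∈ Γ, ∫ ω, X e ω ^ 2 ∂P else 0 := by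
  simp_rw [prod_mul_prod_eq_prod_univ]
  rw [hX.integral_fun_prod_comp (f := fun e x =>
    (if e ∈ Γ then x else 1) * (if e ∈ Δ then x else 1))
    (fun e => (h2 e).aestronglyMeasurable.aemeasurable)
    (fun e => by split_ifs <;> fun_prop)]
  split_ifs with h
  · subst h
    rw [← Finset.univ_inter Γ, ← Finset.prod_ite_mem, Finset.univ_inter]
    refine Finset.prod_congr rfl fun e _ => ?_
    split_ifs <;> simp [sq]
  · obtain ⟨e, he⟩ : ∃ e, ¬ (e ∈ Γ ↔ e ∈ Δ) := by
      by_contra! hc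
      exact h (Finset.ext hc)
    refine Finset.prod_eq_zero (Finset.mem_univ e) ?_
    by_cases h1 : e ∈ Γ <;> by_cases h3 : e ∈ Δ <;> simp_all

include hX h2 in
lemma integrable_sq_sum_prod (c : Finset E → ℝ) :
    Integrable (fun ω => (∑ Γ, c Γ * ∏ e ∈ Γ, X e ω) ^ 2) P := by
  simp_rw [sq, Finset.sum_mul_sum]
  refine integrable_finsetSum _ fun Γ _ => integrable_finsetSum _ fun Δ _ => ?_
  refine ((integrable_prod_mul_prod hX h2 Γ Δ).const_mul (c Γ * c Δ)).congr (ae_of_all _ fun ω => ?_)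
  ring

include hX h2 in
lemma integral_sq_sum_prod (h0 : ∀ e, ∫ ω, X e ω ∂P = 0) (c : Finset E → ℝ) :
    ∫ ω, (∑ Γ, c Γ * ∏ e ∈ Γ, X e ω) ^ 2 ∂P
      = ∑ Γ, c Γ ^ 2 * ∏ e ∈ Γ, ∫ ω, X e ω ^ 2 ∂P := by
  have key : ∀ Γ Δ : Finset E, ∀ ω, c Γ * (∏ e ∈ Γ, X e ω) * (c Δ * ∏ e ∈ Δ, X e ω)
      = (c Γ * c Δ) * ((∏ e ∈ Γ, X e ω) * ∏ e ∈ Δ, X e ω) := fun _ _ _ => by ring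
  have hi : ∀ Γ Δ : Finset E, Integrable
      (fun ω => (c Γ * c Δ) * ((∏ e ∈ Γ, X e ω) * ∏ e ∈ Δ, X e ω)) P := fun Γ Δ =>
    (integrable_prod_mul_prod hX h2 Γ Δ).const_mul _
  simp_rw [sq (∑ _, _), Finset.sum_mul_sum, key]
  rw [integral_finsetSum _ fun Γ _ => integrable_finsetSum _ fun Δ _ => hi Γ Δ]
  refine Finset.sum_congr rfl fun Γ _ => ?_
  rw [integral_finsetSum _ fun Δ _ => hi Γ Δ]
  simp_rw [integral_const_mul, integral_prod_mul_prod hX h2 h0]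
  simp [sq]

end Orthogonal

/-! ### Convergence of characteristic functions -/

section CharFun

lemma cexp_log_eq_cpow {y : ℝ} (hy : 0 < y) (t : ℝ) :
    Complex.exp (t * (Real.log y : ℝ) * Complex.I) = (y : ℂ) ^ ((t : ℂ) * Complex.I) := by
  rw [Complex.cpow_def_of_ne_zero (by exact_mod_cast hy.ne'), Complex.ofReal_log hy.le]
  ring_nf

/-- Integrate the expansion of `(1 + u) ^ (i t)` at `u = c x`. Since `x ≥ -1` and `c ≤ 1/2`, the
point `u` stays in the admissible range; centring kills the linear term, and the third moment
controls the remainder. -/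
lemma exists_norm_charFun_log_one_add_sub_le {ν : Measure ℝ} [IsProbabilityMeasure ν]
    (hν : ∀ᵐ x ∂ν, -1 ≤ x) (h3 : MemLp id 3 ν) (h0 : ∫ x, x ∂ν = 0) (t : ℝ) :
    ∃ C : ℝ, ∀ c : ℝ, 0 ≤ c → c ≤ 1 / 2 →
      ‖charFun (ν.map fun x => Real.log (1 + c * x)) t - 1
        - (t : ℂ) * Complex.I * ((t : ℂ) * Complex.I - 1) / 2 * ((c ^ 2 * ∫ x, x ^ 2 ∂ν : ℝ) : ℂ)‖
        ≤ C * c ^ 3 := by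
  obtain ⟨C, hC, hb⟩ := exists_norm_one_add_cpow_sub_le t
  refine ⟨C * ∫ x, |x| ^ 3 ∂ν, fun c hc0 hc => ?_⟩
  set a : ℂ := (t : ℂ) * Complex.I with ha
  have i1 : Integrable (fun x : ℝ => x) ν := h3.integrable (by norm_num)
  have i2 : Integrable (fun x : ℝ => x ^ 2) ν :=
    (h3.mono_exponent (show (2 : ℝ≥0∞) ≤ 3 by norm_num)).integrable_sq
  have i3 : Integrable (fun x : ℝ => |x| ^ 3) ν := by
    simpa using h3.integrable_norm_pow (by norm_num)
  have hm : Measurable fun x : ℝ => Real.log (1 + c * x) := by fun_prop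
  have ie : Integrable (fun x : ℝ => Complex.exp (t * (Real.log (1 + c * x) : ℝ) * Complex.I)) ν := by
    refine Integrable.of_bound (C := 1) (by apply Measurable.aestronglyMeasurable; fun_prop)
      (ae_of_all _ fun x => ?_)
    rw [show (t : ℂ) * (Real.log (1 + c * x) : ℝ) * Complex.I
      = ((t * Real.log (1 + c * x) : ℝ) : ℂ) * Complex.I by push_cast; ring,
      Complex.norm_exp_ofReal_mul_I]
  have i1' : Integrable (fun x : ℝ => a * ((c * x : ℝ) : ℂ)) ν :=
    ((i1.const_mul c).ofReal).const_mul a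
  have i2' : Integrable (fun x : ℝ => a * (a - 1) / 2 * (((c * x) ^ 2 : ℝ) : ℂ)) ν := by
    simp_rw [mul_pow]
    exact ((i2.const_mul (c ^ 2)).ofReal).const_mul _
  rw [charFun_apply_real, integral_map hm.aemeasurable (by fun_prop)]
  have e1 : ∫ x : ℝ, a * ((c * x : ℝ) : ℂ) ∂ν = 0 := by
    rw [integral_const_mul, integral_complex_ofReal, integral_const_mul, h0]
    simp
  have e2 : ∫ x : ℝ, a * (a - 1) / 2 * (((c * x) ^ 2 : ℝ) : ℂ) ∂ν
      = a * (a - 1) / 2 * ((c ^ 2 * ∫ x, x ^ 2 ∂ν : ℝ) : ℂ) := by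
    simp_rw [mul_pow]
    rw [integral_const_mul, integral_complex_ofReal, integral_const_mul]
  have e0 : ∫ _x : ℝ, (1 : ℂ) ∂ν = 1 := by simp
  rw [← e2]
  have : (∫ x : ℝ, Complex.exp (t * (Real.log (1 + c * x) : ℝ) * Complex.I) ∂ν) - 1
      - ∫ x : ℝ, a * (a - 1) / 2 * (((c * x) ^ 2 : ℝ) : ℂ) ∂ν
      = ∫ x : ℝ, (Complex.exp (t * (Real.log (1 + c * x) : ℝ) * Complex.I) - 1
        - a * ((c * x : ℝ) : ℂ) - a * (a - 1) / 2 * (((c * x) ^ 2 : ℝ) : ℂ)) ∂ν := by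
    have j1 := ie.sub (integrable_const (1 : ℂ))
    have j2 := j1.sub i1'
    rw [integral_sub (f := fun x => Complex.exp (t * (Real.log (1 + c * x) : ℝ) * Complex.I) - 1
        - a * ((c * x : ℝ) : ℂ)) j2 i2', integral_sub (f := fun x : ℝ =>
        Complex.exp (t * (Real.log (1 + c * x) : ℝ) * Complex.I) - 1) j1 i1',
      integral_sub ie (integrable_const _), e1, e0, sub_zero]
  rw [this]
  refine (norm_integral_le_of_norm_le (g := fun x => C * c ^ 3 * |x| ^ 3) (i3.const_mul _) ?_).trans
    (le_of_eq ?_)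
  · filter_upwards [hν] with x hx
    have hx' : -(1 / 2) ≤ c * x := by nlinarith
    rw [cexp_log_eq_cpow (by linarith)]
    refine (le_of_eq ?_).trans ((hb _ hx').trans (le_of_eq ?_))
    · push_cast
      rfl
    · rw [abs_mul, mul_pow, abs_of_nonneg hc0]
      ring
  · rw [integral_const_mul]
    ring

lemma tendsto_charFun_log_one_add_pow {ν : Measure ℝ} [IsProbabilityMeasure ν]
    (hν : ∀ᵐ x ∂ν, -1 ≤ x) (h3 : MemLp id 3 ν) (h0 : ∫ x, x ∂ν = 0) (t : ℝ)
    {c : ℕ → ℝ} {K : ℕ → ℕ} {τ : ℝ} (hc0 : ∀ n, 0 ≤ c n) (hc : Tendsto c atTop (𝓝 0))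
    (hK : Tendsto (fun n => K n * c n ^ 2) atTop (𝓝 τ)) :
    Tendsto (fun n => charFun (ν.map fun x => Real.log (1 + c n * x)) t ^ K n) atTop
      (𝓝 (Complex.exp ((t : ℂ) * Complex.I * ((t : ℂ) * Complex.I - 1) / 2
        * ((τ * ∫ x, x ^ 2 ∂ν : ℝ) : ℂ)))) := by
  obtain ⟨C, hC⟩ := exists_norm_charFun_log_one_add_sub_le hν h3 h0 t
  set b : ℂ := (t : ℂ) * Complex.I * ((t : ℂ) * Complex.I - 1) / 2
  set v := ∫ x, x ^ 2 ∂ν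
  set z : ℕ → ℂ := fun n => charFun (ν.map fun x => Real.log (1 + c n * x)) t - 1 with hz
  have hbound : ∀ᶠ n in atTop, ‖z n - b * ((c n ^ 2 * v : ℝ) : ℂ)‖ ≤ C * c n ^ 3 := by
    filter_upwards [hc.eventually_le_const (show (0 : ℝ) < 1 / 2 by norm_num)] with n hn
    exact hC _ (hc0 n) hn
  have hz0 : Tendsto z atTop (𝓝 0) := by
    have h1 : Tendsto (fun n => z n - b * ((c n ^ 2 * v : ℝ) : ℂ)) atTop (𝓝 0) := by
      refine squeeze_zero_norm' hbound ?_
      simpa using (hc.pow 3).const_mul C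
    have h2 : Tendsto (fun n => b * ((c n ^ 2 * v : ℝ) : ℂ)) atTop (𝓝 0) := by
      have : Tendsto (fun n => c n ^ 2 * v) atTop (𝓝 0) := by simpa using (hc.pow 2).mul_const v
      simpa using ((Complex.continuous_ofReal.tendsto _).comp this).const_mul b
    simpa using h1.add h2
  have hKz : Tendsto (fun n => (K n : ℂ) * z n) atTop (𝓝 (b * ((τ * v : ℝ) : ℂ))) := by
    -- The accumulated error is `K c³ = (K c²) c`, a convergent factor times a vanishing one.
    have h1 : Tendsto (fun n => (K n : ℂ) * (z n - b * ((c n ^ 2 * v : ℝ) : ℂ))) atTop (𝓝 0) := by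
      refine squeeze_zero_norm' (a := fun n => C * ((K n * c n ^ 2) * c n)) ?_ ?_
      · filter_upwards [hbound] with n hn
        rw [norm_mul, Complex.norm_natCast]
        calc (K n : ℝ) * _ ≤ K n * (C * c n ^ 3) := by gcongr
          _ = _ := by ring
      · simpa using (hK.mul hc).const_mul C
    have h2 : Tendsto (fun n => b * (((K n * c n ^ 2) * v : ℝ) : ℂ)) atTop
        (𝓝 (b * ((τ * v : ℝ) : ℂ))) :=
      ((Complex.continuous_ofReal.tendsto _).comp (hK.mul_const v)).const_mul b
    have h3 := h1.add h2
    rw [zero_add] at h3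
    refine h3.congr fun n => ?_
    push_cast
    ring
  refine (tendsto_one_add_pow_exp hz0 hKz).congr fun n => ?_
  simp [hz]

/-- The central limit theorem, in terms of characteristic functions, for the logarithm of a product
of independent factors `1 + c * X`. -/
lemma tendsto_charFun_sum_log_one_add {κ : Type*} [DecidableEq κ] (A : Finset κ) {ν : κ → Measure ℝ}
    [∀ q, IsProbabilityMeasure (ν q)] (hν : ∀ q ∈ A, ∀ᵐ x ∂ν q, -1 ≤ x)
    (h3 : ∀ q ∈ A, MemLp id 3 (ν q)) (h0 : ∀ q ∈ A, ∫ x, x ∂ν q = 0)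
    {E : ℕ → Type*} [∀ n, Fintype (E n)] (bl : ∀ n, E n → κ) (hbl : ∀ n e, bl n e ∈ A)
    {Ω : ℕ → Type*} [∀ n, MeasurableSpace (Ω n)] (P : ∀ n, Measure (Ω n))
    {X : ∀ n, E n → Ω n → ℝ} (hX : ∀ n, iIndepFun (X n) (P n))
    (hlaw : ∀ n e, HasLaw (X n e) (ν (bl n e)) (P n))
    {c : ℕ → κ → ℝ} {τ : κ → ℝ} (hc0 : ∀ n q, 0 ≤ c n q)
    (hc : ∀ q ∈ A, Tendsto (fun n => c n q) atTop (𝓝 0))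
    (hK : ∀ q ∈ A, Tendsto (fun n => ((Finset.univ.filter fun e => bl n e = q).card : ℝ) * c n q ^ 2)
      atTop (𝓝 (τ q))) (t : ℝ) :
    Tendsto (fun n => charFun ((P n).map fun ω => ∑ e, Real.log (1 + c n (bl n e) * X n e ω)) t)
      atTop (𝓝 (Complex.exp ((t : ℂ) * Complex.I * ((t : ℂ) * Complex.I - 1) / 2
        * ((∑ q ∈ A, τ q * ∫ x, x ^ 2 ∂ν q : ℝ) : ℂ)))) := by
  have key : ∀ n, charFun ((P n).map fun ω => ∑ e, Real.log (1 + c n (bl n e) * X n e ω)) t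
      = ∏ q ∈ A, charFun ((ν q).map fun x => Real.log (1 + c n q * x)) t
          ^ (Finset.univ.filter fun e => bl n e = q).card := by
    intro n
    have hf : ∀ e, Measurable fun x : ℝ => Real.log (1 + c n (bl n e) * x) := fun e => by fun_prop
    have hind : iIndepFun (fun e ω => Real.log (1 + c n (bl n e) * X n e ω)) (P n) :=
      (hX n).comp (fun e x => Real.log (1 + c n (bl n e) * x)) hf
    rw [hind.charFun_map_fun_sum_eq_prod (X := fun e ω => Real.log (1 + c n (bl n e) * X n e ω))
      (fun e => (hf e).comp_aemeasurable (hlaw n e).aemeasurable), Finset.prod_apply,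
      ← Finset.prod_fiberwise_of_maps_to (g := bl n) (t := A) (fun e _ => hbl n e)]
    refine Finset.prod_congr rfl fun q _ => ?_
    rw [← Finset.prod_const]
    refine Finset.prod_congr rfl fun e he => ?_
    rw [← (Finset.mem_filter.mp he).2, ← (hlaw n e).map_eq,
      AEMeasurable.map_map_of_aemeasurable (hf e).aemeasurable (hlaw n e).aemeasurable]
    rfl
  simp_rw [key]
  push_cast
  rw [Finset.mul_sum, Complex.exp_sum]
  refine tendsto_finsetProd _ fun q hq => ?_
  have := tendsto_charFun_log_one_add_pow (hν q hq) (h3 q hq) (h0 q hq) t (c := fun n => c n q)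
    (fun n => hc0 n q) (hc q hq) (hK q hq)
  push_cast at this
  exact this

end CharFun

/-! ### Comparison of logarithms -/

section Compare

variable {Ω : ℕ → Type*} [∀ n, MeasurableSpace (Ω n)] {P : ∀ n, Measure (Ω n)}
  [∀ n, IsProbabilityMeasure (P n)]

lemma norm_cexp_sub_cexp_le (t x y : ℝ) :
    ‖Complex.exp (t * x * Complex.I) - Complex.exp (t * y * Complex.I)‖ ≤ |t| * |x - y| := by
  have h : Complex.exp (t * x * Complex.I) - Complex.exp (t * y * Complex.I)
      = Complex.exp (((t * y : ℝ) : ℂ) * Complex.I)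
        * (Complex.exp (Complex.I * ((t * (x - y) : ℝ) : ℂ)) - 1) := by
    rw [mul_sub, ← Complex.exp_add]
    push_cast
    ring_nf
  rw [h, norm_mul, Complex.norm_exp_ofReal_mul_I, one_mul, ← abs_mul]
  exact Real.norm_exp_I_mul_ofReal_sub_one_le

/-- A Slutsky-type lemma for variables on varying probability spaces. -/
lemma tendsto_charFun_of_tendsto_measure_abs_sub {L V : ∀ n, Ω n → ℝ}
    (hL : ∀ n, AEMeasurable (L n) (P n)) (hV : ∀ n, AEMeasurable (V n) (P n))
    (h : ∀ ε > 0, Tendsto (fun n => P n {x | ε ≤ |V n x - L n x|}) atTop (𝓝 0)) {t : ℝ} {z : ℂ}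
    (hz : Tendsto (fun n => charFun ((P n).map (L n)) t) atTop (𝓝 z)) :
    Tendsto (fun n => charFun ((P n).map (V n)) t) atTop (𝓝 z) := by
  -- Off the event, `s ↦ exp (i t s)` is `|t|`-Lipschitz; on it, two numbers of modulus one differ
  -- by at most `2`.
  have hbound : ∀ ε > 0, ∀ n, ‖charFun ((P n).map (V n)) t - charFun ((P n).map (L n)) t‖
      ≤ |t| * ε + 2 * (P n).real {x | ε ≤ |V n x - L n x|} := by
    intro ε hε n
    have hint : ∀ U : Ω n → ℝ, AEMeasurable U (P n) →
        Integrable (fun x => Complex.exp (t * U x * Complex.I)) (P n) := by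
      intro U hU
      refine Integrable.of_bound (C := 1) (by fun_prop) (ae_of_all _ fun x => ?_)
      rw [show (t : ℂ) * U x * Complex.I = ((t * U x : ℝ) : ℂ) * Complex.I by push_cast; ring,
        Complex.norm_exp_ofReal_mul_I]
    have hms : NullMeasurableSet {x | ε ≤ |V n x - L n x|} (P n) :=
      nullMeasurableSet_le aemeasurable_const ((hV n).sub (hL n)).abs
    rw [charFun_apply_real, charFun_apply_real, integral_map (hV n) (by fun_prop),
      integral_map (hL n) (by fun_prop), ← integral_sub (hint _ (hV n)) (hint _ (hL n))]
    refine (norm_integral_le_of_norm_le (g := fun x => |t| * ε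
      + 2 * Set.indicator {x | ε ≤ |V n x - L n x|} (fun _ => (1 : ℝ)) x) ?_ (ae_of_all _ fun x => ?_)).trans
      (le_of_eq ?_)
    · exact (integrable_const _).add
        (((integrable_const (1 : ℝ)).indicator₀ hms).const_mul 2)
    · by_cases hx : ε ≤ |V n x - L n x|
      · have h1 : ∀ y : ℝ, ‖Complex.exp (t * y * Complex.I)‖ = 1 := fun y => by
          rw [show (t : ℂ) * y * Complex.I = ((t * y : ℝ) : ℂ) * Complex.I by push_cast; ring,
            Complex.norm_exp_ofReal_mul_I]
        refine (norm_sub_le _ _).trans ?_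
        rw [h1, h1, Set.indicator_of_mem (by exact hx)]
        have : 0 ≤ |t| * ε := by positivity
        linarith
      · rw [Set.indicator_of_notMem (by exact hx), mul_zero, add_zero]
        exact (norm_cexp_sub_cexp_le t _ _).trans
          (mul_le_mul_of_nonneg_left (not_le.mp hx).le (abs_nonneg _))
    · rw [integral_add (integrable_const _)
        (((integrable_const (1 : ℝ)).indicator₀ hms).const_mul 2), integral_const_mul 2,
        integral_indicator₀ hms]
      simp
  have hdiff : Tendsto (fun n => charFun ((P n).map (V n)) t - charFun ((P n).map (L n)) t)
      atTop (𝓝 0) := by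
    rw [NormedAddGroup.tendsto_nhds_zero]
    intro δ hδ
    obtain ⟨ε, hε, hε'⟩ : ∃ ε > 0, |t| * ε < δ / 2 := by
      refine ⟨δ / (4 * (|t| + 1)), by positivity, ?_⟩
      rw [mul_div_assoc', div_lt_div_iff₀ (by positivity) (by norm_num)]
      nlinarith [abs_nonneg t]
    have hr : Tendsto (fun n => 2 * (P n).real {x | ε ≤ |V n x - L n x|}) atTop (𝓝 0) := by
      have := (ENNReal.tendsto_toReal ENNReal.zero_ne_top).comp (h ε hε)
      simpa [Measure.real] using this.const_mul 2
    filter_upwards [hr.eventually_lt_const (half_pos hδ)] with n hn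
    have := hbound ε hε n
    linarith
  simpa using hdiff.add hz

/-- If the laws of `L n` converge (in the sense of characteristic functions) and `W n - exp (L n)`
tends to zero in probability, then `W n` is positive with probability tending to one, and
`log (W n) - L n` tends to zero in probability. -/
lemma tendsto_measure_nonpos_or_le_abs_log_sub {L W : ∀ n, Ω n → ℝ} {f : ℝ → ℂ}
    (hL : ∀ n, AEMeasurable (L n) (P n)) (hf : ContinuousAt f 0)
    (hLf : ∀ t, Tendsto (fun n => charFun ((P n).map (L n)) t) atTop (𝓝 (f t)))
    (hW : ∀ ε > 0, Tendsto (fun n => P n {x | ε ≤ |W n x - Real.exp (L n x)|}) atTop (𝓝 0))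
    {ε : ℝ} (hε : 0 < ε) :
    Tendsto (fun n => P n {x | W n x ≤ 0 ∨ ε ≤ |Real.log (W n x) - L n x|}) atTop (𝓝 0) := by
  have : ∀ n, IsProbabilityMeasure ((P n).map (L n)) := fun n =>
    Measure.isProbabilityMeasure_map (hL n)
  have ht := tendsto_measure_norm_gt_of_isTightMeasureSet
    (isTightMeasureSet_of_tendsto_charFun hf hLf)
  rw [ENNReal.tendsto_nhds_zero]
  intro δ hδ
  have hδ2 : 0 < δ / 2 := ENNReal.half_pos hδ.ne'
  obtain ⟨R, hR⟩ := (ENNReal.tendsto_nhds_zero.mp ht (δ / 2) hδ2).exists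
  obtain ⟨η, hη, hη1, hηε⟩ : ∃ η > 0, η < 1 ∧ ∀ u : ℝ, |u - 1| < η → |Real.log u| < ε := by
    have hc := Metric.continuousAt_iff.mp (Real.continuousAt_log one_ne_zero) ε hε
    obtain ⟨η, hη, h⟩ := hc
    refine ⟨min η (1 / 2), by positivity, by
      exact (min_le_right _ _).trans_lt (by norm_num), fun u hu => ?_⟩
    have := h (x := u) (by rw [Real.dist_eq]; exact hu.trans_le (min_le_left _ _))
    simpa [Real.dist_eq] using this
  -- When `|L| ≤ R`, an absolute error below this threshold is a relative error below `η`, since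
  -- then `exp L ≥ exp (-R)`.
  have hpos : 0 < Real.exp (-R) * η := by positivity
  filter_upwards [ENNReal.tendsto_nhds_zero.mp (hW _ hpos) (δ / 2) hδ2] with n hn
  have h1 : P n {x | R < ‖L n x‖} ≤ δ / 2 := by
    have h2 : (P n).map (L n) {x | R < ‖x‖} ≤ δ / 2 := by
      refine le_trans ?_ hR
      exact le_iSup₂ (f := fun (μ : Measure ℝ) (_ : μ ∈ Set.range fun n => (P n).map (L n)) =>
        μ {x | R < ‖x‖}) _ ⟨n, rfl⟩
    rwa [Measure.map_apply_of_aemeasurable (hL n)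
      (measurableSet_lt measurable_const measurable_norm)] at h2
  calc P n {x | W n x ≤ 0 ∨ ε ≤ |Real.log (W n x) - L n x|}
      ≤ P n ({x | R < ‖L n x‖} ∪ {x | Real.exp (-R) * η ≤ |W n x - Real.exp (L n x)|}) := by
        refine measure_mono fun x hx => ?_
        by_contra hcon
        simp only [Set.mem_union, Set.mem_ofPred_eq, not_or, not_lt, not_le] at hcon
        obtain ⟨hc1, hc2⟩ := hcon
        have hLR : -R ≤ L n x := (abs_le.mp hc1).1
        have hexp : Real.exp (-R) ≤ Real.exp (L n x) := Real.exp_le_exp.mpr hLR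
        have hlt : |W n x - Real.exp (L n x)| < η * Real.exp (L n x) := by nlinarith
        have hep := Real.exp_pos (L n x)
        have hWpos : 0 < W n x := by nlinarith [(abs_lt.mp hlt).1]
        rcases hx with hx | hx
        · exact absurd hWpos (not_lt.mpr hx)
        · have hu := hηε (W n x / Real.exp (L n x)) (by
            rw [div_sub_one hep.ne', abs_div, abs_of_pos hep, div_lt_iff₀ hep]
            exact hlt)
          rw [Real.log_div hWpos.ne' hep.ne', Real.log_exp] at hu
          exact absurd hu (not_lt.mpr hx)
    _ ≤ _ := measure_union_le _ _
    _ ≤ δ / 2 + δ / 2 := add_le_add h1 hn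
    _ = δ := ENNReal.add_halves δ

end Compare

/-! ### Sums over sets of edges -/

section Sums

variable {E : Type*} [Fintype E]

lemma sum_prod_le_exp {a : E → ℝ} (ha : ∀ e, 0 ≤ a e) :
    ∑ Γ : Finset E, ∏ e ∈ Γ, a e ≤ Real.exp (∑ e, a e) := by
  have := Finset.prod_one_add (f := a) Finset.univ
  rw [Finset.powerset_univ] at this
  rw [← this]
  exact Real.prod_one_add_le_exp_sum _ ha

/-- Deleting `e` and `f` is injective on the sets containing both, and pulls out the factor `a e * a
f`. -/
lemma sum_prod_filter_mem_le [DecidableEq E] {a : E → ℝ} (ha : ∀ e, 0 ≤ a e) {e f : E} (hef : e ≠ f) :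
    ∑ Γ with e ∈ Γ ∧ f ∈ Γ, ∏ g ∈ Γ, a g ≤ a e * a f * ∑ Γ : Finset E, ∏ g ∈ Γ, a g := by
  have hinj : Set.InjOn (fun Γ : Finset E => (Γ.erase e).erase f)
      (Finset.univ.filter fun Γ : Finset E => e ∈ Γ ∧ f ∈ Γ) := by
    intro Γ hΓ Δ hΔ h
    simp only [Finset.coe_filter, Finset.mem_univ, true_and, Set.mem_ofPred_eq] at hΓ hΔ h
    have h' := congrArg (fun T => insert e (insert f T)) h
    rwa [Finset.insert_erase (Finset.mem_erase.mpr ⟨hef.symm, hΓ.2⟩), Finset.insert_erase hΓ.1,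
      Finset.insert_erase (Finset.mem_erase.mpr ⟨hef.symm, hΔ.2⟩), Finset.insert_erase hΔ.1] at h'
  calc ∑ Γ with e ∈ Γ ∧ f ∈ Γ, ∏ g ∈ Γ, a g
      = ∑ Γ : Finset E with e ∈ Γ ∧ f ∈ Γ, a e * a f * ∏ g ∈ (Γ.erase e).erase f, a g := by
        refine Finset.sum_congr rfl fun Γ hΓ => ?_
        obtain ⟨he, hf⟩ := (Finset.mem_filter.mp hΓ).2
        rw [mul_assoc, Finset.mul_prod_erase _ _ (Finset.mem_erase.mpr ⟨hef.symm, hf⟩),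
          Finset.mul_prod_erase _ _ he]
    _ = a e * a f * ∑ Γ ∈ (Finset.univ.filter fun Γ : Finset E => e ∈ Γ ∧ f ∈ Γ).image
          (fun Γ : Finset E => (Γ.erase e).erase f), ∏ g ∈ Γ, a g := by
        rw [Finset.sum_image hinj, Finset.mul_sum]
    _ ≤ _ := by
        refine mul_le_mul_of_nonneg_left ?_ (mul_nonneg (ha e) (ha f))
        exact Finset.sum_le_sum_of_subset_of_nonneg (Finset.subset_univ _)
          fun Γ _ _ => Finset.prod_nonneg fun g _ => ha g

open Classical in
/-- The variance bound: `Q Γ` is close to `∏ p` on the sets satisfying `M`, and every other set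
contains a pair of related elements. -/
lemma sum_sq_sub_prod_mul_prod_le {Q : Finset E → ℝ} {p v : E → ℝ} {M : Finset E → Prop}
    {r : E → E → Prop} {R δ D : ℝ} (hv : ∀ e, 0 ≤ v e)
    (hM : ∀ Γ, M Γ → |Q Γ - ∏ e ∈ Γ, p e| ≤ δ * (R ^ Γ.card * ∏ e ∈ Γ, p e))
    (hnM : ∀ Γ, ¬ M Γ → |Q Γ - ∏ e ∈ Γ, p e| ≤ R ^ Γ.card * ∏ e ∈ Γ, p e)
    (hr : ∀ Γ, ¬ M Γ → ∃ e ∈ Γ, ∃ f ∈ Γ, e ≠ f ∧ r e f)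
    (hD : ∀ e, ∑ f with r e f, R ^ 2 * p f ^ 2 * v f ≤ D) :
    ∑ Γ : Finset E, (Q Γ - ∏ e ∈ Γ, p e) ^ 2 * ∏ e ∈ Γ, v e
      ≤ (δ ^ 2 + (∑ e, R ^ 2 * p e ^ 2 * v e) * D) * Real.exp (∑ e, R ^ 2 * p e ^ 2 * v e) := by
  -- Absorbing `R ^ Γ.card` into per-element weights keeps the sum over `Γ` equal to a product `∏ (1
  -- + a e)`.
  set a : E → ℝ := fun e => R ^ 2 * p e ^ 2 * v e with ha_def
  have ha : ∀ e, 0 ≤ a e := fun e => by have := hv e; positivity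
  have hprod : ∀ Γ : Finset E, (R ^ Γ.card * ∏ e ∈ Γ, p e) ^ 2 * ∏ e ∈ Γ, v e = ∏ e ∈ Γ, a e := by
    intro Γ
    rw [ha_def]
    simp only [Finset.prod_mul_distrib, Finset.prod_const, Finset.prod_pow]
    ring
  have hpa : ∀ Γ : Finset E, 0 ≤ ∏ e ∈ Γ, a e := fun Γ => Finset.prod_nonneg fun e _ => ha e
  have hpv : ∀ Γ : Finset E, 0 ≤ ∏ e ∈ Γ, v e := fun Γ => Finset.prod_nonneg fun e _ => hv e
  set T : Finset (E × E) := Finset.univ.filter fun x => x.1 ≠ x.2 ∧ r x.1 x.2 with hT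
  -- A union bound: a set failing `M` contains some pair in `T`, so it appears at least once in the
  -- second sum.
  have hterm : ∀ Γ : Finset E, (Q Γ - ∏ e ∈ Γ, p e) ^ 2 * ∏ e ∈ Γ, v e
      ≤ δ ^ 2 * (∏ e ∈ Γ, a e)
        + ∑ x ∈ T, if x.1 ∈ Γ ∧ x.2 ∈ Γ then ∏ e ∈ Γ, a e else 0 := by
    intro Γ
    have hsum0 : ∀ x ∈ T, 0 ≤ if x.1 ∈ Γ ∧ x.2 ∈ Γ then ∏ e ∈ Γ, a e else 0 := by
      intro x _
      split_ifs
      exacts [hpa Γ, le_rfl]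
    by_cases h : M Γ
    · calc (Q Γ - ∏ e ∈ Γ, p e) ^ 2 * ∏ e ∈ Γ, v e
          ≤ (δ * (R ^ Γ.card * ∏ e ∈ Γ, p e)) ^ 2 * ∏ e ∈ Γ, v e :=
            mul_le_mul_of_nonneg_right (sq_le_sq' (abs_le.mp (hM Γ h)).1 (abs_le.mp (hM Γ h)).2)
              (hpv Γ)
        _ = δ ^ 2 * ∏ e ∈ Γ, a e := by rw [mul_pow, mul_assoc, hprod]
        _ ≤ _ := le_add_of_nonneg_right (Finset.sum_nonneg hsum0)
    · obtain ⟨e, he, f, hf, hef, hr'⟩ := hr Γ h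
      calc (Q Γ - ∏ e ∈ Γ, p e) ^ 2 * ∏ e ∈ Γ, v e
          ≤ (R ^ Γ.card * ∏ e ∈ Γ, p e) ^ 2 * ∏ e ∈ Γ, v e :=
            mul_le_mul_of_nonneg_right (sq_le_sq' (abs_le.mp (hnM Γ h)).1 (abs_le.mp (hnM Γ h)).2)
              (hpv Γ)
        _ = if (e, f).1 ∈ Γ ∧ (e, f).2 ∈ Γ then ∏ e ∈ Γ, a e else 0 := by
            rw [hprod, if_pos ⟨he, hf⟩]
        _ ≤ ∑ x ∈ T, if x.1 ∈ Γ ∧ x.2 ∈ Γ then ∏ e ∈ Γ, a e else 0 :=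
            Finset.single_le_sum (f := fun x : E × E =>
              if x.1 ∈ Γ ∧ x.2 ∈ Γ then ∏ e ∈ Γ, a e else 0) hsum0
              (Finset.mem_filter.mpr ⟨Finset.mem_univ _, hef, hr'⟩)
        _ ≤ _ := le_add_of_nonneg_left (mul_nonneg (sq_nonneg _) (hpa Γ))
  set U := ∑ Γ : Finset E, ∏ e ∈ Γ, a e with hU
  have hU0 : 0 ≤ U := Finset.sum_nonneg fun Γ _ => hpa Γ
  have hTsum : ∑ x ∈ T, a x.1 * a x.2 ≤ (∑ e, a e) * D := by
    calc ∑ x ∈ T, a x.1 * a x.2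
        ≤ ∑ x : E × E, if r x.1 x.2 then a x.1 * a x.2 else 0 := by
          rw [hT, Finset.sum_filter]
          refine Finset.sum_le_sum fun x _ => ?_
          have := mul_nonneg (ha x.1) (ha x.2)
          split_ifs with h1 h2 h2
          exacts [le_rfl, absurd h1.2 h2, this, le_rfl]
      _ = ∑ e, a e * ∑ f with r e f, a f := by
          rw [Fintype.sum_prod_type]
          refine Finset.sum_congr rfl fun e _ => ?_
          rw [Finset.mul_sum, Finset.sum_filter]
      _ ≤ ∑ e, a e * D := Finset.sum_le_sum fun e _ => mul_le_mul_of_nonneg_left (hD e) (ha e)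
      _ = _ := by rw [Finset.sum_mul]
  calc ∑ Γ : Finset E, (Q Γ - ∏ e ∈ Γ, p e) ^ 2 * ∏ e ∈ Γ, v e
      ≤ ∑ Γ : Finset E, (δ ^ 2 * (∏ e ∈ Γ, a e)
        + ∑ x ∈ T, if x.1 ∈ Γ ∧ x.2 ∈ Γ then ∏ e ∈ Γ, a e else 0) :=
        Finset.sum_le_sum fun Γ _ => hterm Γ
    _ = δ ^ 2 * U + ∑ x ∈ T, ∑ Γ with x.1 ∈ Γ ∧ x.2 ∈ Γ, ∏ e ∈ Γ, a e := by
        rw [Finset.sum_add_distrib, ← Finset.mul_sum, Finset.sum_comm]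
        simp_rw [Finset.sum_filter]
        rfl
    _ ≤ δ ^ 2 * U + ∑ x ∈ T, a x.1 * a x.2 * U := by
        gcongr with x hx
        exact sum_prod_filter_mem_le ha (Finset.mem_filter.mp hx).2.1
    _ = (δ ^ 2 + ∑ x ∈ T, a x.1 * a x.2) * U := by rw [← Finset.sum_mul]; ring
    _ ≤ (δ ^ 2 + (∑ e, a e) * D) * U := by gcongr
    _ ≤ _ := by
        refine mul_le_mul_of_nonneg_left (sum_prod_le_exp ha) ?_
        refine add_nonneg (sq_nonneg _) (le_trans ?_ hTsum)
        exact Finset.sum_nonneg fun x _ => mul_nonneg (ha _) (ha _)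

end Sums

/-! ### Counting edges of the block graph -/

section Graph

variable {ℓ : ℕ} {A : Finset (Sym2 (Fin ℓ))} {N : Fin ℓ → ℕ}

noncomputable instance : Fintype (Edge A N) := Fintype.ofFinite _

lemma blocks_mem (e : Edge A N) : blocks e ∈ A := by
  obtain ⟨e, he⟩ := e
  induction e using Sym2.ind with
  | _ x y => exact he.2

lemma card_filter_blocks_eq (q : Sym2 (Fin ℓ)) :
    (Finset.univ.filter fun e : Edge A N => blocks e = q).card = (blockEdges A N q).ncard := by
  rw [← Set.ncard_coe_finset]
  congr 1
  ext e
  simp [blockEdges]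

lemma card_filter_mem_le (x : Vertex N) [DecidablePred fun f : Edge A N => x ∈ f.1] :
    (Finset.univ.filter fun f : Edge A N => x ∈ f.1).card ≤ ∑ i, N i := by
  classical
  calc (Finset.univ.filter fun f : Edge A N => x ∈ f.1).card
      = ((Finset.univ.filter fun f : Edge A N => x ∈ f.1).image Subtype.val).card :=
        (Finset.card_image_of_injective _ Subtype.val_injective).symm
    _ ≤ (Finset.univ.image fun y : Vertex N => s(x, y)).card := by
        refine Finset.card_le_card fun z hz => ?_
        obtain ⟨f, hf, rfl⟩ := Finset.mem_image.mp hz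
        obtain ⟨y, hy⟩ := (Finset.mem_filter.mp hf).2
        exact Finset.mem_image.mpr ⟨y, Finset.mem_univ _, hy.symm⟩
    _ ≤ (Finset.univ : Finset (Vertex N)).card := Finset.card_image_le
    _ = ∑ i, N i := by simp

lemma card_filter_exists_mem_le (e : Edge A N)
    [DecidablePred fun f : Edge A N => ∃ v, v ∈ e.1 ∧ v ∈ f.1] :
    (Finset.univ.filter fun f : Edge A N => ∃ v, v ∈ e.1 ∧ v ∈ f.1).card ≤ 2 * ∑ i, N i := by
  classical
  obtain ⟨⟨x, y⟩, he⟩ := e.1.exists_rep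
  have hsub : (Finset.univ.filter fun f : Edge A N => ∃ v, v ∈ e.1 ∧ v ∈ f.1)
      ⊆ (Finset.univ.filter fun f : Edge A N => x ∈ f.1)
        ∪ (Finset.univ.filter fun f : Edge A N => y ∈ f.1) := by
    intro f hf
    obtain ⟨v, hv, hvf⟩ := (Finset.mem_filter.mp hf).2
    rw [← he] at hv
    rcases Sym2.mem_iff.mp hv with rfl | rfl <;> simp [hvf]
  refine (Finset.card_le_card hsub).trans ((Finset.card_union_le _ _).trans ?_)
  rw [two_mul]
  exact add_le_add (card_filter_mem_le x) (card_filter_mem_le y)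

lemma card_filter_fst_eq (s : Fin ℓ) :
    (Finset.univ.filter fun x : Vertex N => x.1 = s).card = N s := by
  have : (Finset.univ.filter fun x : Vertex N => x.1 = s)
      = Finset.univ.map (Function.Embedding.sigmaMk (β := fun i => Fin (N i)) s) := by
    ext ⟨i, j⟩
    simp only [Finset.mem_filter, Finset.mem_univ, true_and, Finset.mem_map,
      Function.Embedding.sigmaMk_apply]
    constructor
    · rintro rfl
      exact ⟨j, rfl⟩
    · rintro ⟨j', hj⟩
      exact (congrArg Sigma.fst hj).symm
  rw [this, Finset.card_map, Finset.card_univ, Fintype.card_fin]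

/-- Count ordered pairs of vertices from the two blocks. Those off the diagonal map to edges at most
two to one, and the diagonal, which can be nonempty only for `s = t`, has at most `N s` elements.
This treats both cases at once. -/
lemma mul_le_two_mul_ncard_blockEdges {s t : Fin ℓ} (h : s(s, t) ∈ A) :
    N s * N t ≤ 2 * (blockEdges A N s(s, t)).ncard + N s := by
  classical
  set B : Fin ℓ → Finset (Vertex N) := fun i => Finset.univ.filter fun x => x.1 = i with hB
  have hprod : (B s ×ˢ B t).card = N s * N t := by
    rw [Finset.card_product, card_filter_fst_eq, card_filter_fst_eq]
  have hdiag : ((B s ×ˢ B t).filter fun z => z.1 = z.2).card ≤ N s := by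
    rw [← card_filter_fst_eq (N := N) s]
    refine Finset.card_le_card_of_injOn Prod.fst (fun z hz => ?_) ?_
    · exact (Finset.mem_product.mp (Finset.mem_filter.mp hz).1).1
    · intro z hz z' hz' hzz
      have h1 := (Finset.mem_filter.mp hz).2
      have h2 := (Finset.mem_filter.mp hz').2
      exact Prod.ext hzz (h1.symm.trans (hzz.trans h2))
  have hoff : ((B s ×ˢ B t).filter fun z => ¬ z.1 = z.2).card
      ≤ 2 * (blockEdges A N s(s, t)).ncard := by
    rw [← card_filter_blocks_eq, ← Finset.card_map (Function.Embedding.subtype _)]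
    refine Finset.card_le_mul_card_image_of_maps_to (f := fun z => s(z.1, z.2)) ?_ 2 ?_
    · rintro ⟨x, y⟩ hz
      obtain ⟨hz1, hz2⟩ := Finset.mem_filter.mp hz
      obtain ⟨hx, hy⟩ := Finset.mem_product.mp hz1
      have hx' : x.1 = s := (Finset.mem_filter.mp hx).2
      have hy' : y.1 = t := (Finset.mem_filter.mp hy).2
      refine Finset.mem_map.mpr ⟨⟨s(x, y), ⟨hz2, ?_⟩⟩, ?_, rfl⟩
      · rw [hx', hy']
        exact h
      · refine Finset.mem_filter.mpr ⟨Finset.mem_univ _, ?_⟩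
        simp [blocks, hx', hy']
    · intro b _
      induction b using Sym2.ind with
      | _ u w =>
        refine (Finset.card_le_card (t := {(u, w), (w, u)}) fun z hz => ?_).trans
          Finset.card_le_two
        have := (Finset.mem_filter.mp hz).2
        obtain ⟨x, y⟩ := z
        simp only [Sym2.eq_iff] at this
        simp only [Finset.mem_insert, Finset.mem_singleton, Prod.mk.injEq]
        exact this
  rw [← hprod, ← Finset.card_filter_add_card_filter_not (s := B s ×ˢ B t) (fun z => z.1 = z.2)]
  omega

/-- Each `E_{s,t}` contains a positive proportion of all pairs of vertices. -/
lemma exists_eventually_mul_sq_le_ncard {N : ℕ → Fin ℓ → ℕ} {lam : Fin ℓ → ℝ}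
    (hN : Tendsto (fun n => ∑ i, N n i) atTop atTop) (hlam_pos : ∀ i, 0 < lam i)
    (hlam : ∀ i, Tendsto (fun n => (N n i : ℝ) / ((∑ j, N n j : ℕ) : ℝ)) atTop (𝓝 (lam i)))
    {q : Sym2 (Fin ℓ)} (hq : q ∈ A) :
    ∃ κ > 0, ∀ᶠ n in atTop,
      κ * ((∑ i, N n i : ℕ) : ℝ) ^ 2 ≤ ((blockEdges A (N n) q).ncard : ℝ) := by
  induction q using Sym2.ind with
  | _ s t =>
    have hpos := mul_pos (hlam_pos s) (hlam_pos t)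
    -- One factor `1/2` absorbs the convergence error, the other the double counting of edges.
    refine ⟨lam s * lam t / 4, by positivity, ?_⟩
    have hV : Tendsto (fun n => ((∑ i, N n i : ℕ) : ℝ)) atTop atTop :=
      tendsto_natCast_atTop_atTop.comp hN
    have hlim : Tendsto (fun n => (N n s : ℝ) / ((∑ j, N n j : ℕ) : ℝ)
        * ((N n t : ℝ) / ((∑ j, N n j : ℕ) : ℝ))
        - (N n s : ℝ) / ((∑ j, N n j : ℕ) : ℝ) * ((∑ j, N n j : ℕ) : ℝ)⁻¹) atTop
        (𝓝 (lam s * lam t - lam s * 0)) :=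
      ((hlam s).mul (hlam t)).sub ((hlam s).mul (tendsto_inv_atTop_zero.comp hV))
    rw [mul_zero, sub_zero] at hlim
    filter_upwards [hlim.eventually_const_le (show lam s * lam t / 2 < lam s * lam t by linarith),
      hV.eventually_gt_atTop 0] with n hn hVn
    have hcount : (N n s : ℝ) * N n t ≤ 2 * ((blockEdges A (N n) s(s, t)).ncard : ℝ) + N n s := by
      exact_mod_cast mul_le_two_mul_ncard_blockEdges (N := N n) hq
    set V := ((∑ i, N n i : ℕ) : ℝ)
    have h1 : (N n s : ℝ) / V * (N n t / V) - N n s / V * V⁻¹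
        = (N n s * N n t - N n s) / V ^ 2 := by
      field_simp
    rw [h1, le_div_iff₀ (by positivity)] at hn
    linarith

end Graph

/-! ### Boltzmann factors of a single weight -/

section Weight

/-- The real number `exp (-β ω)`. -/
noncomputable def boltz (β : ℝ) (x : EReal) : ℝ := (EReal.exp (-((β : EReal) * x))).toReal

/-- The normalised and centred Boltzmann factor. -/
noncomputable def centred (μ : Measure EReal) (β : ℝ) (x : EReal) : ℝ :=
  boltz β x / (laplace μ β).toReal - 1

lemma boltz_nonneg (β : ℝ) (x : EReal) : 0 ≤ boltz β x := ENNReal.toReal_nonneg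

lemma measurable_exp_neg_mul (β : ℝ) :
    Measurable fun x : EReal => EReal.exp (-((β : EReal) * x)) :=
  EReal.measurable_exp.comp (measurable_const.mul measurable_id).neg

lemma measurable_boltz (β : ℝ) : Measurable (boltz β) :=
  (measurable_exp_neg_mul β).ennreal_toReal

lemma measurable_centred (μ : Measure EReal) (β : ℝ) : Measurable (centred μ β) :=
  ((measurable_boltz β).div_const _).sub_const _

lemma neg_one_le_centred (μ : Measure EReal) (β : ℝ) (x : EReal) : -1 ≤ centred μ β x := by
  have : 0 ≤ boltz β x / (laplace μ β).toReal :=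
    div_nonneg (boltz_nonneg β x) ENNReal.toReal_nonneg
  unfold centred
  linarith

lemma exp_neg_mul_pow (β : ℝ) (x : EReal) (k : ℕ) :
    EReal.exp (-((β : EReal) * x)) ^ k = EReal.exp (-(((k * β : ℝ) : EReal) * x)) := by
  rw [← EReal.exp_nmul]
  congr 1
  rw [EReal.coe_mul, mul_neg, mul_assoc]
  rfl

lemma boltz_pow (β : ℝ) (x : EReal) (k : ℕ) : boltz β x ^ k = boltz (k * β) x := by
  rw [boltz, ← ENNReal.toReal_pow, exp_neg_mul_pow, boltz]

variable {μ : Measure EReal}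

lemma integral_boltz {β : ℝ} (h : laplace μ β < ∞) : ∫ x, boltz β x ∂μ = (laplace μ β).toReal :=
  integral_toReal (measurable_exp_neg_mul β).aemeasurable
    (ae_lt_top (measurable_exp_neg_mul β) h.ne)

lemma integrable_boltz {β : ℝ} (h : laplace μ β < ∞) : Integrable (boltz β) μ :=
  integrable_toReal_of_lintegral_ne_top (measurable_exp_neg_mul β).aemeasurable h.ne

/-- The `k`-th power of `exp (-β ω)` is `exp (-kβ ω)`, so moments are values of the Laplace
transform. -/
lemma memLp_boltz {β : ℝ} {k : ℕ} (hk : k ≠ 0) (h : laplace μ (k * β) < ∞) :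
    MemLp (boltz β) k μ := by
  rw [← integrable_norm_rpow_iff (measurable_boltz β).aestronglyMeasurable (by simpa)
    (by simp)]
  refine (integrable_boltz h).congr (ae_of_all _ fun x => ?_)
  simp [Real.norm_of_nonneg (boltz_nonneg β x), boltz_pow]

lemma memLp_centred [IsProbabilityMeasure μ] {β : ℝ} {k : ℕ} (hk : k ≠ 0) (h : laplace μ (k * β) < ∞) :
    MemLp (centred μ β) k μ := by
  refine MemLp.sub (f := fun x => boltz β x / (laplace μ β).toReal) (g := fun _ => (1 : ℝ))
    ?_ (memLp_const 1)
  simp_rw [div_eq_mul_inv]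
  exact (memLp_boltz hk h).mul_const _

variable {β : ℝ} (h0 : 0 < laplace μ β) (h1 : laplace μ β < ∞)

include h0 h1

lemma integral_centred [IsProbabilityMeasure μ] : ∫ x, centred μ β x ∂μ = 0 := by
  have hpos : 0 < (laplace μ β).toReal := ENNReal.toReal_pos h0.ne' h1.ne
  unfold centred
  rw [integral_sub ((integrable_boltz h1).div_const _) (integrable_const _), integral_div,
    integral_boltz h1, div_self hpos.ne']
  simp

lemma exp_psi : Real.exp (psi μ β) = (laplace μ β).toReal :=
  Real.exp_log (ENNReal.toReal_pos h0.ne' h1.ne)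

lemma integral_centred_sq [IsProbabilityMeasure μ] (h2 : 0 < laplace μ (2 * β)) (h3 : laplace μ (2 * β) < ∞) :
    ∫ x, centred μ β x ^ 2 ∂μ = vSq μ β := by
  have hpos : 0 < (laplace μ β).toReal := ENNReal.toReal_pos h0.ne' h1.ne
  have hsq : ∀ x, centred μ β x ^ 2 = boltz (2 * β) x / (laplace μ β).toReal ^ 2
      - 2 * centred μ β x - 1 := by
    intro x
    have := boltz_pow β x 2
    norm_num at this
    rw [← this, centred]
    field_simp
    ring
  have hc : Integrable (centred μ β) μ :=
    ((integrable_boltz h1).div_const _).sub (integrable_const _)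
  have hb : Integrable (fun x => boltz (2 * β) x / (laplace μ β).toReal ^ 2) μ :=
    (integrable_boltz h3).div_const _
  have hbc : Integrable (fun x => boltz (2 * β) x / (laplace μ β).toReal ^ 2
    - 2 * centred μ β x) μ := hb.sub (hc.const_mul 2)
  simp_rw [hsq]
  rw [integral_sub hbc (integrable_const _), integral_sub hb (hc.const_mul 2), integral_div,
    integral_const_mul, integral_boltz h3, integral_centred h0 h1, vSq, Real.exp_sub, exp_psi h2 h3,
    two_mul (psi μ β), Real.exp_add, exp_psi h0 h1]
  simp [sq]

end Weight

/-! ### The partition function -/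

section Partition

variable {ℓ : ℕ} {A : Finset (Sym2 (Fin ℓ))} {N : Fin ℓ → ℕ}

lemma totalWeight_ne_bot {w : Edge A N → EReal} (hw : ∀ e, w e ≠ ⊥) (π : Finset (Edge A N)) :
    totalWeight w π ≠ ⊥ := by
  induction π using Finset.cons_induction with
  | empty => simp [totalWeight]
  | cons e π he ih =>
    rw [totalWeight, Finset.sum_cons]
    exact EReal.add_ne_bot_iff.mpr ⟨hw e, ih⟩

lemma coe_mul_ne_bot {β : ℝ} (hβ : 0 < β) {x : EReal} (hx : x ≠ ⊥) : (β : EReal) * x ≠ ⊥ := by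
  induction x with
  | bot => exact absurd rfl hx
  | coe x => exact_mod_cast EReal.coe_ne_bot (β * x)
  | top => simp [EReal.coe_mul_top_of_pos hβ]

/-- Excluding `⊥` prevents the sum from mixing `⊤` with `⊥`, where the exponential would no longer
be multiplicative. -/
lemma exp_neg_mul_totalWeight {w : Edge A N → EReal} (hw : ∀ e, w e ≠ ⊥) {β : ℝ} (hβ : 0 < β)
    (π : Finset (Edge A N)) :
    EReal.exp (-((β : EReal) * totalWeight w π)) = ∏ e ∈ π, EReal.exp (-((β : EReal) * w e)) := by
  induction π using Finset.cons_induction with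
  | empty => simp [totalWeight]
  | cons e π he ih =>
    have h1 := coe_mul_ne_bot hβ (hw e)
    have h2 := coe_mul_ne_bot hβ (totalWeight_ne_bot hw π)
    rw [Finset.prod_cons, ← ih, ← EReal.exp_add]
    unfold totalWeight at h2 ⊢
    rw [Finset.sum_cons, EReal.left_distrib_of_nonneg_of_ne_top
      (by exact_mod_cast hβ.le) (EReal.coe_ne_top β), EReal.neg_add (Or.inl h1) (Or.inr h2),
      sub_eq_add_neg]

lemma exp_neg_mul_ne_top {β : ℝ} (hβ : 0 < β) {x : EReal} (hx : x ≠ ⊥) :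
    EReal.exp (-((β : EReal) * x)) ≠ ∞ := by
  rw [Ne, EReal.exp_eq_top_iff, EReal.neg_eq_top_iff]
  exact coe_mul_ne_bot hβ hx

lemma toReal_partitionFn (S : Finset (Finset (Edge A N)))
    {w : Edge A N → EReal} (hw : ∀ e, w e ≠ ⊥) {β : ℝ} (hβ : 0 < β) :
    (partitionFn S w β).toReal = (S.card : ℝ)⁻¹ * ∑ π ∈ S, ∏ e ∈ π, boltz β (w e) := by
  rw [partitionFn, ENNReal.toReal_mul, ENNReal.toReal_inv, ENNReal.toReal_natCast,
    ENNReal.toReal_sum fun π _ => exp_neg_mul_ne_top hβ (totalWeight_ne_bot hw π)]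
  simp_rw [exp_neg_mul_totalWeight hw hβ, ENNReal.toReal_prod]
  rfl

/-- Expand each product over subsets and exchange sums: `Γ` is then counted once for each `π ⊇ Γ`.
-/
lemma average_prod_one_add (S : Finset (Finset (Edge A N))) (x : Edge A N → ℝ) :
    (S.card : ℝ)⁻¹ * ∑ π ∈ S, ∏ e ∈ π, (1 + x e) = ∑ Γ, inclProb S Γ * ∏ e ∈ Γ, x e := by
  have h1 : ∀ π : Finset (Edge A N), ∏ e ∈ π, (1 + x e)
      = ∑ Γ : Finset (Edge A N), if Γ ⊆ π then ∏ e ∈ Γ, x e else 0 := by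
    intro π
    rw [Finset.prod_one_add, ← Finset.sum_filter]
    refine Finset.sum_congr ?_ fun _ _ => rfl
    ext Γ
    simp
  simp_rw [h1]
  rw [Finset.sum_comm, Finset.mul_sum]
  refine Finset.sum_congr rfl fun Γ _ => ?_
  rw [← Finset.sum_filter, Finset.sum_const, nsmul_eq_mul, inclProb]
  ring

/-- The partition function in terms of centred variables. -/
lemma toReal_partitionFn_eq_exp_mul {S : Finset (Finset (Edge A N))} {m : Sym2 (Fin ℓ) → ℕ}
    (hm : ∀ π ∈ S, ∀ q ∈ A, (π.filter fun e => blocks e = q).card = m q)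
    {μ : Sym2 (Fin ℓ) → Measure EReal} {β : ℝ} (hβ : 0 < β)
    (hμ : ∀ q ∈ A, 0 < laplace (μ q) β ∧ laplace (μ q) β < ∞)
    {w : Edge A N → EReal} (hw : ∀ e, w e ≠ ⊥) :
    (partitionFn S w β).toReal = Real.exp (∑ q ∈ A, (m q : ℝ) * psi (μ q) β)
      * ∑ Γ, inclProb S Γ * ∏ e ∈ Γ, centred (μ (blocks e)) β (w e) := by
  rw [← average_prod_one_add, toReal_partitionFn S hw hβ, mul_left_comm, Finset.mul_sum _ _ (Real.exp _)]
  congr 1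
  refine Finset.sum_congr rfl fun π hπ => ?_
  have h1 : Real.exp (∑ q ∈ A, (m q : ℝ) * psi (μ q) β)
      = ∏ e ∈ π, (laplace (μ (blocks e)) β).toReal := by
    rw [Real.exp_sum, ← Finset.prod_fiberwise_of_maps_to (g := blocks) (t := A)
      fun e _ => blocks_mem e]
    refine Finset.prod_congr rfl fun q hq => ?_
    have h2 : ∏ e ∈ π with blocks e = q, (laplace (μ (blocks e)) β).toReal
        = ∏ e ∈ π with blocks e = q, (laplace (μ q) β).toReal :=
      Finset.prod_congr rfl fun e he => by rw [(Finset.mem_filter.mp he).2]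
    rw [h2, Finset.prod_const, hm π hπ q hq, Real.exp_nat_mul]
    congr 1
    exact Real.exp_log (ENNReal.toReal_pos (hμ q hq).1.ne' (hμ q hq).2.ne)
  rw [h1, ← Finset.prod_mul_distrib]
  refine Finset.prod_congr rfl fun e _ => ?_
  have hpos : 0 < (laplace (μ (blocks e)) β).toReal :=
    ENNReal.toReal_pos (hμ _ (blocks_mem e)).1.ne' (hμ _ (blocks_mem e)).2.ne
  rw [centred]
  field_simp
  ring

/-- Double counting of pairs (edge of the given block pair, configuration containing it). -/
lemma inclProb_singleton_eq {S : Finset (Finset (Edge A N))} (hS : S.Nonempty)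
    {m : Sym2 (Fin ℓ) → ℕ}
    (hm : ∀ π ∈ S, ∀ q ∈ A, (π.filter fun e => blocks e = q).card = m q)
    (hunif : ∀ e f : Edge A N, blocks e = blocks f → inclProb S {e} = inclProb S {f})
    (e : Edge A N) :
    inclProb S {e} = m (blocks e) / ((blockEdges A N (blocks e)).ncard : ℝ) := by
  classical
  have hScard : (0 : ℝ) < S.card := by exact_mod_cast hS.card_pos
  have hsum : ∑ f with blocks f = blocks e, inclProb S {f} = m (blocks e) := by
    have h1 : ∑ f with blocks f = blocks e, ((S.filter fun π => {f} ⊆ π).card : ℝ)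
        = ∑ π ∈ S, ((π.filter fun f => blocks f = blocks e).card : ℝ) := by
      simp_rw [Finset.card_filter, Nat.cast_sum]
      rw [Finset.sum_comm]
      refine Finset.sum_congr rfl fun π _ => ?_
      simp only [Finset.singleton_subset_iff, Nat.cast_ite, Nat.cast_one, Nat.cast_zero]
      rw [← Finset.sum_filter, ← Finset.sum_filter, Finset.filter_filter]
      refine Finset.sum_congr ?_ fun _ _ => rfl
      ext f
      simp [and_comm]
    simp_rw [inclProb]
    rw [← Finset.sum_div, h1, Finset.sum_congr rfl fun π hπ => by
      rw [hm π hπ _ (blocks_mem e)], Finset.sum_const, nsmul_eq_mul]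
    field_simp
  have hcard : 0 < (Finset.univ.filter fun f : Edge A N => blocks f = blocks e).card :=
    Finset.card_pos.mpr ⟨e, by simp⟩
  rw [Finset.sum_congr rfl fun f hf => hunif f e (Finset.mem_filter.mp hf).2, Finset.sum_const,
    nsmul_eq_mul, card_filter_blocks_eq] at hsum
  rw [card_filter_blocks_eq] at hcard
  rw [eq_div_iff (by exact_mod_cast hcard.ne'), mul_comm]
  exact hsum

lemma inclProb_nonneg (S : Finset (Finset (Edge A N))) (Γ : Finset (Edge A N)) :
    0 ≤ inclProb S Γ := by
  unfold inclProb
  positivity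

lemma inclProb_pos {S : Finset (Finset (Edge A N))} {Γ : Finset (Edge A N)}
    (h : ∃ π ∈ S, Γ ⊆ π) : 0 < inclProb S Γ := by
  obtain ⟨π, hπ, hΓ⟩ := h
  have h1 : 0 < (S.filter fun π => Γ ⊆ π).card :=
    Finset.card_pos.mpr ⟨π, Finset.mem_filter.mpr ⟨hπ, hΓ⟩⟩
  have h2 : 0 < S.card := Finset.card_pos.mpr ⟨π, hπ⟩
  unfold inclProb
  positivity

lemma inclProb_eq_zero {S : Finset (Finset (Edge A N))} {Γ : Finset (Edge A N)}
    (h : ¬ ∃ π ∈ S, Γ ⊆ π) : inclProb S Γ = 0 := by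
  have : S.filter (fun π => Γ ⊆ π) = ∅ :=
    Finset.filter_eq_empty_iff.mpr fun π hπ hΓ => h ⟨π, hπ, hΓ⟩
  simp [inclProb, this]

/-- Inclusion probabilities are nearly multiplicative, in a weighted mean-square sense. -/
lemma sum_sq_inclProb_sub_prod_le {S : Finset (Finset (Edge A N))}
    (hext : ∀ Γ : Finset (Edge A N), IsPartialMatching Γ → ∃ π ∈ S, Γ ⊆ π) {ρ₁ ρ₂ R δ : ℝ}
    (hρ₁ : 0 < ρ₁) (hρ₂ : 0 < ρ₂) (h1R : 1 ≤ R) (hR₁ : ρ₁ ≤ R) (hR₂ : ρ₂ ≤ R) (hδ : 0 ≤ δ)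
    (hmatch : ∀ Γ : Finset (Edge A N), IsPartialMatching Γ →
      |inclProb S Γ / (∏ e ∈ Γ, inclProb S {e}) - 1| ≤ ρ₁ ^ Γ.card * δ)
    (hnonmatch : ∀ Γ : Finset (Edge A N), (∃ π ∈ S, Γ ⊆ π) → ¬ IsPartialMatching Γ →
      inclProb S Γ ≤ ρ₂ ^ Γ.card * ∏ e ∈ Γ, inclProb S {e})
    {c u : Sym2 (Fin ℓ) → ℝ} (hc : ∀ e : Edge A N, inclProb S {e} = c (blocks e))
    (hu : ∀ q ∈ A, 0 ≤ u q) :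
    ∑ Γ : Finset (Edge A N), (inclProb S Γ - ∏ e ∈ Γ, c (blocks e)) ^ 2 * ∏ e ∈ Γ, u (blocks e)
      ≤ (δ ^ 2 + (∑ q ∈ A, ((blockEdges A N q).ncard : ℝ) * (R ^ 2 * c q ^ 2 * u q))
          * (2 * ((∑ i, N i : ℕ) : ℝ) * ∑ q ∈ A, R ^ 2 * c q ^ 2 * u q))
        * Real.exp (∑ q ∈ A, ((blockEdges A N q).ncard : ℝ) * (R ^ 2 * c q ^ 2 * u q)) := by
  classical
  have hR0 : 0 ≤ R := zero_le_one.trans h1R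
  have hsum : ∑ e : Edge A N, R ^ 2 * c (blocks e) ^ 2 * u (blocks e)
      = ∑ q ∈ A, ((blockEdges A N q).ncard : ℝ) * (R ^ 2 * c q ^ 2 * u q) := by
    rw [← Finset.sum_fiberwise_of_maps_to (g := blocks) (t := A) fun e _ => blocks_mem e]
    refine Finset.sum_congr rfl fun q _ => ?_
    rw [Finset.sum_congr rfl (g := fun _ => R ^ 2 * c q ^ 2 * u q)
      fun e he => by rw [(Finset.mem_filter.mp he).2], Finset.sum_const, nsmul_eq_mul,
      card_filter_blocks_eq]
  -- A single edge is a partial matching, hence lies in some configuration; this makes the quotient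
  -- in `hmatch` a genuine one.
  have hsingle : ∀ e : Edge A N, 0 < inclProb S {e} := fun e =>
    inclProb_pos (hext _ (by
      intro f hf g hg hfg
      rw [Finset.mem_singleton] at hf hg
      exact absurd (hf.trans hg.symm) hfg))
  have hprod : ∀ Γ : Finset (Edge A N), 0 < ∏ e ∈ Γ, c (blocks e) := fun Γ =>
    Finset.prod_pos fun e _ => hc e ▸ hsingle e
  simp_rw [hc] at hmatch hnonmatch
  rw [← hsum]
  refine sum_sq_sub_prod_mul_prod_le (M := IsPartialMatching)
    (r := fun e f => ∃ v, v ∈ e.1 ∧ v ∈ f.1) (fun e => hu _ (blocks_mem e)) ?_ ?_ ?_ ?_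
  · intro Γ hΓ
    have h1 := hmatch Γ hΓ
    have h2 : inclProb S Γ - ∏ e ∈ Γ, c (blocks e)
        = (inclProb S Γ / (∏ e ∈ Γ, c (blocks e)) - 1) * ∏ e ∈ Γ, c (blocks e) := by
      rw [sub_mul, div_mul_cancel₀ _ (hprod Γ).ne', one_mul]
    rw [h2, abs_mul, abs_of_pos (hprod Γ)]
    calc _ ≤ ρ₁ ^ Γ.card * δ * ∏ e ∈ Γ, c (blocks e) :=
          mul_le_mul_of_nonneg_right h1 (hprod Γ).le
      _ ≤ R ^ Γ.card * δ * ∏ e ∈ Γ, c (blocks e) := by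
          have := (hprod Γ).le
          gcongr
      _ = _ := by ring
  · intro Γ hΓ
    -- Both the inclusion probability (possibly zero) and the product lie between `0` and `R ^
    -- Γ.card` times the product; `R ≥ 1` is needed for the latter.
    have h1 : 1 ≤ R ^ Γ.card := one_le_pow₀ h1R
    have h2 : ∏ e ∈ Γ, c (blocks e) ≤ R ^ Γ.card * ∏ e ∈ Γ, c (blocks e) :=
      le_mul_of_one_le_left (hprod Γ).le h1
    have h3 : inclProb S Γ ≤ R ^ Γ.card * ∏ e ∈ Γ, c (blocks e) := by
      by_cases h : ∃ π ∈ S, Γ ⊆ π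
      · refine (hnonmatch Γ h hΓ).trans ?_
        have := (hprod Γ).le
        gcongr
      · rw [inclProb_eq_zero h]
        exact (hprod Γ).le.trans h2
    rw [abs_le]
    constructor <;> linarith [inclProb_nonneg S Γ, hprod Γ]
  · intro Γ hΓ
    unfold IsPartialMatching at hΓ
    push Not at hΓ
    obtain ⟨e, he, f, hf, hef, v, hv⟩ := hΓ
    exact ⟨e, he, f, hf, hef, v, hv⟩
  · intro e
    have hnn : ∀ q ∈ A, 0 ≤ R ^ 2 * c q ^ 2 * u q := fun q hq => by
      have := hu q hq
      positivity
    -- Each edge meeting `e` has weight at most the sum over all block pairs, and there are at most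
    -- `2 * ∑ i, N i` such edges.
    refine (Finset.sum_le_sum (g := fun _ => ∑ q ∈ A, R ^ 2 * c q ^ 2 * u q) fun f _ =>
      Finset.single_le_sum (f := fun q => R ^ 2 * c q ^ 2 * u q) hnn (blocks_mem f)).trans ?_
    rw [Finset.sum_const, nsmul_eq_mul]
    refine mul_le_mul_of_nonneg_right ?_ (Finset.sum_nonneg hnn)
    rw [← Nat.cast_ofNat (R := ℝ), ← Nat.cast_mul]
    refine Nat.cast_le.mpr ?_
    convert card_filter_exists_mem_le e

end Partition

/-! ### Asymptotics of the edge densities -/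

section Scalars

variable {K V m : ℕ → ℝ} {g : ℝ}

lemma tendsto_mul_div_sq (h : Tendsto (fun n => m n ^ 2 / (2 * K n)) atTop (𝓝 g)) :
    Tendsto (fun n => K n * (m n / K n) ^ 2) atTop (𝓝 (2 * g)) := by
  refine (h.const_mul 2).congr fun n => ?_
  rcases eq_or_ne (K n) 0 with h0 | h0
  · simp [h0]
  · field_simp

lemma tendsto_atTop_of_eventually_mul_sq_le {κ : ℝ} (hκ : 0 < κ) (hV : Tendsto V atTop atTop)
    (h : ∀ᶠ n in atTop, κ * V n ^ 2 ≤ K n) : Tendsto K atTop atTop :=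
  tendsto_atTop_mono' _ h (((tendsto_pow_atTop two_ne_zero).comp hV).const_mul_atTop hκ)

lemma tendsto_div_of_eventually_mul_sq_le {κ : ℝ} (hκ : 0 < κ) (hV : Tendsto V atTop atTop)
    (h : ∀ᶠ n in atTop, κ * V n ^ 2 ≤ K n) : Tendsto (fun n => V n / K n) atTop (𝓝 0) := by
  have h1 : Tendsto (fun n => κ⁻¹ * (V n)⁻¹) atTop (𝓝 0) := by
    simpa using (tendsto_inv_atTop_zero.comp hV).const_mul κ⁻¹
  refine squeeze_zero' ?_ ?_ h1
  · filter_upwards [h, hV.eventually_gt_atTop 0] with n hn hVn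
    have : 0 ≤ K n := le_trans (by positivity) hn
    positivity
  · filter_upwards [h, hV.eventually_gt_atTop 0] with n hn hVn
    rw [← mul_inv, ← one_div, div_le_div_iff₀ (lt_of_lt_of_le (by positivity) hn) (by positivity)]
    linarith

lemma tendsto_div_zero_of_tendsto_sq_div (hm : ∀ n, 0 ≤ m n) (hK : Tendsto K atTop atTop)
    (h : Tendsto (fun n => m n ^ 2 / (2 * K n)) atTop (𝓝 g)) :
    Tendsto (fun n => m n / K n) atTop (𝓝 0) := by
  have h1 : Tendsto (fun n => (K n * (m n / K n) ^ 2) * (K n)⁻¹) atTop (𝓝 0) := by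
    simpa using (tendsto_mul_div_sq h).mul (tendsto_inv_atTop_zero.comp hK)
  have h2 := (Real.continuous_sqrt.tendsto 0).comp h1
  rw [Real.sqrt_zero] at h2
  refine h2.congr' ?_
  filter_upwards [hK.eventually_gt_atTop 0] with n hn
  have : K n * (m n / K n) ^ 2 * (K n)⁻¹ = (m n / K n) ^ 2 := by field_simp
  rw [Function.comp_apply, this, Real.sqrt_sq (div_nonneg (hm n) hn.le)]

lemma tendsto_atTop_of_tendsto_sq_div (hm : ∀ n, 0 ≤ m n) (hK : Tendsto K atTop atTop)
    (hg : 0 < g) (h : Tendsto (fun n => m n ^ 2 / (2 * K n)) atTop (𝓝 g)) :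
    Tendsto m atTop atTop := by
  have h1 := Real.tendsto_sqrt_atTop.comp (h.pos_mul_atTop hg (hK.const_mul_atTop two_pos))
  refine h1.congr' ?_
  filter_upwards [hK.eventually_gt_atTop 0] with n hn
  rw [Function.comp_apply, div_mul_cancel₀ _ (by positivity), Real.sqrt_sq (hm n)]

end Scalars

/-! ### The second moment of the difference between the two products -/

section Main

variable {ℓ : ℕ} {A : Finset (Sym2 (Fin ℓ))} {N : Fin ℓ → ℕ} {μ : Sym2 (Fin ℓ) → Measure EReal}
  {Ω : Type*} [MeasurableSpace Ω] {P : Measure Ω} {w : Edge A N → Ω → EReal} {β : ℝ}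

/-- At `⊥` the Boltzmann factor is infinite, so finiteness of its mean already forces weights in
`(-∞, ∞]` almost surely. -/
lemma ae_forall_ne_bot (hβ : 0 < β) (hμ : ∀ q ∈ A, laplace (μ q) β < ∞)
    (hlaw : ∀ e, HasLaw (w e) (μ (blocks e)) P) : ∀ᵐ x ∂P, ∀ e, w e x ≠ ⊥ := by
  rw [ae_all_iff]
  intro e
  have h1 : ∀ᵐ y ∂μ (blocks e), y ≠ ⊥ := by
    filter_upwards [ae_lt_top (measurable_exp_neg_mul β) (hμ _ (blocks_mem e)).ne] with y hy hbot
    rw [hbot, EReal.coe_mul_bot_of_pos hβ] at hy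
    simp at hy
  rw [← (hlaw e).map_eq] at h1
  exact ae_of_ae_map (hlaw e).aemeasurable h1

lemma hasLaw_centred (hlaw : ∀ e, HasLaw (w e) (μ (blocks e)) P) (e : Edge A N) :
    HasLaw (fun x => centred (μ (blocks e)) β (w e x))
      ((μ (blocks e)).map (centred (μ (blocks e)) β)) P where
  aemeasurable := (measurable_centred _ _).comp_aemeasurable (hlaw e).aemeasurable
  map_eq := by
    nth_rewrite 3 [← (hlaw e).map_eq]
    rw [AEMeasurable.map_map_of_aemeasurable (measurable_centred _ _).aemeasurable
      (hlaw e).aemeasurable]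
    rfl

lemma iIndepFun_centred (hindep : iIndepFun w P) :
    iIndepFun (fun e x => centred (μ (blocks e)) β (w e x)) P :=
  hindep.comp (fun e => centred (μ (blocks e)) β) fun _ => measurable_centred _ _

variable [∀ q, IsProbabilityMeasure (μ q)] [IsProbabilityMeasure P] (hβ : 0 < β)
  (hμ : ∀ q ∈ A, ∀ b : ℝ, 0 < b → 0 < laplace (μ q) b ∧ laplace (μ q) b < ∞)

include hβ hμ

lemma vSq_nonneg {q : Sym2 (Fin ℓ)} (hq : q ∈ A) : 0 ≤ vSq (μ q) β := by
  have h2 := hμ q hq (2 * β) (by positivity)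
  rw [← integral_centred_sq (hμ q hq β hβ).1 (hμ q hq β hβ).2 h2.1 h2.2]
  exact integral_nonneg fun x => sq_nonneg _

/-- The product expands into the same monomials with coefficients `∏ p e`, so the difference is
again an orthogonal sum. -/
lemma integrable_and_integral_sq_sub_prod (hlaw : ∀ e, HasLaw (w e) (μ (blocks e)) P)
    (hindep : iIndepFun w P) (Q : Finset (Edge A N) → ℝ) (p : Edge A N → ℝ) :
    Integrable (fun x => (∑ Γ, Q Γ * ∏ e ∈ Γ, centred (μ (blocks e)) β (w e x)
        - ∏ e, (1 + p e * centred (μ (blocks e)) β (w e x))) ^ 2) P ∧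
      ∫ x, (∑ Γ, Q Γ * ∏ e ∈ Γ, centred (μ (blocks e)) β (w e x)
        - ∏ e, (1 + p e * centred (μ (blocks e)) β (w e x))) ^ 2 ∂P
      = ∑ Γ : Finset (Edge A N), (Q Γ - ∏ e ∈ Γ, p e) ^ 2 * ∏ e ∈ Γ, vSq (μ (blocks e)) β := by
  classical
  set X : Edge A N → Ω → ℝ := fun e x => centred (μ (blocks e)) β (w e x) with hX
  have hXind : iIndepFun X P := iIndepFun_centred hindep
  have hX2 : ∀ e, MemLp (X e) 2 P := by
    intro e
    have h1 : MemLp (centred (μ (blocks e)) β) 2 (P.map (w e)) := by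
      rw [(hlaw e).map_eq]
      exact memLp_centred (k := 2) two_ne_zero
        (by exact_mod_cast (hμ _ (blocks_mem e) (2 * β) (by positivity)).2)
    exact h1.comp_of_map (hlaw e).aemeasurable
  have hX0 : ∀ e, ∫ x, X e x ∂P = 0 := fun e => by
    have h := hμ _ (blocks_mem e) β hβ
    rw [← integral_centred h.1 h.2]
    exact (hlaw e).integral_comp (measurable_centred _ _).aestronglyMeasurable
  have hXv : ∀ e, ∫ x, X e x ^ 2 ∂P = vSq (μ (blocks e)) β := fun e => by
    have h := hμ _ (blocks_mem e) β hβ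
    have h2 := hμ _ (blocks_mem e) (2 * β) (by positivity)
    rw [← integral_centred_sq h.1 h.2 h2.1 h2.2]
    exact (hlaw e).integral_comp (f := fun y => centred (μ (blocks e)) β y ^ 2)
      ((measurable_centred _ _).pow_const 2).aestronglyMeasurable
  have hexp : ∀ x, ∑ Γ, Q Γ * ∏ e ∈ Γ, X e x - ∏ e, (1 + p e * X e x)
      = ∑ Γ : Finset (Edge A N), (Q Γ - ∏ e ∈ Γ, p e) * ∏ e ∈ Γ, X e x := by
    intro x
    rw [Finset.prod_one_add, Finset.powerset_univ, ← Finset.sum_sub_distrib]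
    simp_rw [Finset.prod_mul_distrib, sub_mul]
  change Integrable (fun x => (∑ Γ, Q Γ * ∏ e ∈ Γ, X e x - ∏ e, (1 + p e * X e x)) ^ 2) P ∧
    ∫ x, (∑ Γ, Q Γ * ∏ e ∈ Γ, X e x - ∏ e, (1 + p e * X e x)) ^ 2 ∂P = _
  simp_rw [hexp, ← hXv]
  exact ⟨integrable_sq_sum_prod hXind hX2 _, integral_sq_sum_prod hXind hX2 hX0 _⟩

end Main

end BlockCLT

theorem theorem2p10
    -- blocks, and the pairs of blocks that are joined by edges
    (ℓ : ℕ) (hℓ : 2 ≤ ℓ) (A : Finset (Sym2 (Fin ℓ)))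
    -- block sizes and their limiting proportions
    (N : ℕ → Fin ℓ → ℕ) (lam : Fin ℓ → ℝ)
    (hN : Tendsto (fun n => ∑ i, N n i) atTop atTop)
    (hlam_pos : ∀ i, 0 < lam i)
    (hlam : ∀ i, Tendsto (fun n => (N n i : ℝ) / ((∑ j, N n j : ℕ) : ℝ)) atTop (𝓝 (lam i)))
    -- the configurations have fixed edge counts in every block pair
    (S : ∀ n, Finset (Finset (BlockCLT.Edge A (N n))))
    (m : ℕ → Sym2 (Fin ℓ) → ℕ) (γ : Sym2 (Fin ℓ) → ℝ)
    (hm : ∀ n, ∀ π ∈ S n, ∀ q ∈ A, (π.filter (fun e => BlockCLT.blocks e = q)).card = m n q)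
    (hγ_pos : ∀ q ∈ A, 0 < γ q)
    (hγ : ∀ q ∈ A, Tendsto
      (fun n => (m n q : ℝ) ^ 2 / (2 * ((BlockCLT.blockEdges A (N n) q).ncard : ℝ)))
      atTop (𝓝 (γ q)))
    -- edges of the same block pair are equally likely to lie in a uniform configuration
    (hunif : ∀ n, ∀ e f : BlockCLT.Edge A (N n), BlockCLT.blocks e = BlockCLT.blocks f →
      BlockCLT.inclProb (S n) {e} = BlockCLT.inclProb (S n) {f})
    -- every partial matching extends to a configuration
    (hext : ∀ n, ∀ Γ : Finset (BlockCLT.Edge A (N n)), BlockCLT.IsPartialMatching Γ →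
      ∃ π ∈ S n, Γ ⊆ π)
    -- asymptotic independence along partial matchings
    (hmatch : ∃ ρ : ℝ, 0 < ρ ∧ ∀ n, ∀ Γ : Finset (BlockCLT.Edge A (N n)),
      BlockCLT.IsPartialMatching Γ →
      |BlockCLT.inclProb (S n) Γ / (∏ e ∈ Γ, BlockCLT.inclProb (S n) {e}) - 1|
        ≤ ρ ^ Γ.card / Real.sqrt ((∑ q ∈ A, m n q : ℕ) : ℝ))
    -- upper bound for the other subgraphs of configurations
    (hnonmatch : ∃ ρ : ℝ, 0 < ρ ∧ ∀ n, ∀ Γ : Finset (BlockCLT.Edge A (N n)),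
      (∃ π ∈ S n, Γ ⊆ π) → ¬ BlockCLT.IsPartialMatching Γ →
      BlockCLT.inclProb (S n) Γ ≤ ρ ^ Γ.card * ∏ e ∈ Γ, BlockCLT.inclProb (S n) {e})
    -- independent weights in `(-∞, ∞]`, whose laws depend only on the block pair
    (μ : Sym2 (Fin ℓ) → Measure EReal) [∀ q, IsProbabilityMeasure (μ q)]
    (hμ : ∀ q ∈ A, ∀ b : ℝ, 0 < b →
      0 < BlockCLT.laplace (μ q) b ∧ BlockCLT.laplace (μ q) b < ∞)
    (Ω : ℕ → Type*) [∀ n, MeasurableSpace (Ω n)]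
    (P : ∀ n, Measure (Ω n)) [∀ n, IsProbabilityMeasure (P n)]
    (w : ∀ n, BlockCLT.Edge A (N n) → Ω n → EReal)
    (hw_law : ∀ n, ∀ e, HasLaw (w n e) (μ (BlockCLT.blocks e)) (P n))
    (hw_indep : ∀ n, iIndepFun (w n) (P n))
    (β : ℝ) (hβ : 0 < β) :
    -- `Z(β) > 0` with probability tending to one, so that `log Z(β)` is a real number
    Tendsto (fun n => P n {x | BlockCLT.partitionFn (S n) (fun e => w n e x) β = 0}) atTop (𝓝 0) ∧
    TendstoInDistribution
      (fun n x => Real.log (BlockCLT.partitionFn (S n) (fun e => w n e x) β).toReal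
        - ∑ q ∈ A, (m n q : ℝ) * BlockCLT.psi (μ q) β)
      atTop
      (fun y : ℝ => y)
      P
      (gaussianReal (-∑ q ∈ A, γ q * BlockCLT.vSq (μ q) β)
        (Real.toNNReal (2 * ∑ q ∈ A, γ q * BlockCLT.vSq (μ q) β))) := by
  open BlockCLT in
  classical
  obtain ⟨ρ₁, hρ₁, hmatch⟩ := hmatch
  obtain ⟨ρ₂, hρ₂, hnonmatch⟩ := hnonmatch
  set R : ℝ := max 1 (max ρ₁ ρ₂) with hR
  have h1R : 1 ≤ R := le_max_left _ _
  have hR₁ : ρ₁ ≤ R := (le_max_left _ _).trans (le_max_right _ _)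
  have hR₂ : ρ₂ ≤ R := (le_max_right _ _).trans (le_max_right _ _)
  set K : ℕ → Sym2 (Fin ℓ) → ℝ := fun n q => ((blockEdges A (N n) q).ncard : ℝ) with hKdef
  set V : ℕ → ℝ := fun n => ((∑ i, N n i : ℕ) : ℝ) with hVdef
  set c : ℕ → Sym2 (Fin ℓ) → ℝ := fun n q => m n q / K n q with hcdef
  set u : Sym2 (Fin ℓ) → ℝ := fun q => vSq (μ q) β with hudef
  have hu : ∀ q ∈ A, 0 ≤ u q := fun q hq => vSq_nonneg hβ hμ hq
  have hμβ : ∀ q ∈ A, 0 < laplace (μ q) β ∧ laplace (μ q) β < ∞ := fun q hq => hμ q hq β hβ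
  have hSne : ∀ n, (S n).Nonempty := fun n => by
    obtain ⟨π, hπ, -⟩ := hext n ∅ (by simp [IsPartialMatching])
    exact ⟨π, hπ⟩
  have hc : ∀ n (e : Edge A (N n)), inclProb (S n) {e} = c n (blocks e) := fun n e =>
    inclProb_singleton_eq (hSne n) (hm n) (hunif n) e
  have hc0 : ∀ n q, 0 ≤ c n q := fun n q => by positivity
  have hV : Tendsto V atTop atTop := tendsto_natCast_atTop_atTop.comp hN
  have hKinf : ∀ q ∈ A, Tendsto (fun n => K n q) atTop atTop := fun q hq => by
    obtain ⟨κ, hκ, h⟩ := exists_eventually_mul_sq_le_ncard hN hlam_pos hlam hq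
    exact tendsto_atTop_of_eventually_mul_sq_le hκ hV h
  have hVK : ∀ q ∈ A, Tendsto (fun n => V n / K n q) atTop (𝓝 0) := fun q hq => by
    obtain ⟨κ, hκ, h⟩ := exists_eventually_mul_sq_le_ncard hN hlam_pos hlam hq
    exact tendsto_div_of_eventually_mul_sq_le hκ hV h
  have hKc : ∀ q ∈ A, Tendsto (fun n => K n q * c n q ^ 2) atTop (𝓝 (2 * γ q)) := fun q hq =>
    tendsto_mul_div_sq (hγ q hq)
  have hclim : ∀ q ∈ A, Tendsto (fun n => c n q) atTop (𝓝 0) := fun q hq =>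
    tendsto_div_zero_of_tendsto_sq_div (fun n => Nat.cast_nonneg _) (hKinf q hq) (hγ q hq)
  have hδ : Tendsto (fun n => (√((∑ q ∈ A, m n q : ℕ) : ℝ))⁻¹ ^ 2) atTop (𝓝 0) := by
    -- Without block pairs the total edge count is `0`, and the convention `0⁻¹ = 0` makes the error
    -- term vanish.
    rcases A.eq_empty_or_nonempty with rfl | ⟨q, hq⟩
    · simp
    have h1 := tendsto_atTop_of_tendsto_sq_div (fun n => Nat.cast_nonneg _) (hKinf q hq)
      (hγ_pos q hq) (hγ q hq)
    have h2 : Tendsto (fun n => ((∑ q ∈ A, m n q : ℕ) : ℝ)) atTop atTop :=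
      tendsto_atTop_mono (fun n => Nat.cast_le.mpr
        (Finset.single_le_sum (f := m n) (fun _ _ => Nat.zero_le _) hq)) h1
    refine (tendsto_inv_atTop_zero.comp h2).congr fun n => ?_
    rw [inv_pow, Real.sq_sqrt (Nat.cast_nonneg _)]
    rfl
  set W : ∀ n, Ω n → ℝ := fun n x => ∑ Γ, inclProb (S n) Γ
    * ∏ e ∈ Γ, centred (μ (blocks e)) β (w n e x) with hW
  set L : ∀ n, Ω n → ℝ := fun n x => ∑ e : Edge A (N n),
    Real.log (1 + c n (blocks e) * centred (μ (blocks e)) β (w n e x)) with hL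
  have hXm : ∀ n (e : Edge A (N n)),
      AEMeasurable (fun x => centred (μ (blocks e)) β (w n e x)) (P n) := fun n e =>
    (measurable_centred _ _).comp_aemeasurable (hw_law n e).aemeasurable
  have hLm : ∀ n, AEMeasurable (L n) (P n) := fun n =>
    Finset.aemeasurable_fun_sum _ fun e _ =>
      Real.measurable_log.comp_aemeasurable (((hXm n e).const_mul _).const_add 1)
  have hWm : ∀ n, AEMeasurable (W n) (P n) := fun n =>
    Finset.aemeasurable_fun_sum _ fun Γ _ =>
      (Finset.aemeasurable_fun_prod _ fun e _ => hXm n e).const_mul _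
  -- the product `exp L` satisfies the limit theorem
  set s : ℝ := ∑ q ∈ A, γ q * u q with hs
  have hs0 : 0 ≤ s := Finset.sum_nonneg fun q hq => mul_nonneg (hγ_pos q hq).le (hu q hq)
  have hLchar : ∀ t : ℝ, Tendsto (fun n => charFun ((P n).map (L n)) t) atTop
      (𝓝 (charFun (gaussianReal (-s) (Real.toNNReal (2 * s))) t)) := by
    intro t
    set ν : Sym2 (Fin ℓ) → Measure ℝ := fun q => (μ q).map (centred (μ q) β) with hν
    have : ∀ q, IsProbabilityMeasure (ν q) := fun q =>
      Measure.isProbabilityMeasure_map (measurable_centred _ _).aemeasurable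
    have hint : ∀ q ∈ A, ∫ x, x ^ 2 ∂ν q = u q := fun q hq => by
      have h2 := hμ q hq (2 * β) (by positivity)
      rw [hν, integral_map (measurable_centred _ _).aemeasurable (by fun_prop)]
      exact integral_centred_sq (hμβ q hq).1 (hμβ q hq).2 h2.1 h2.2
    have key := tendsto_charFun_sum_log_one_add A (ν := ν)
      (fun q _ => by
        rw [hν, ae_map_iff (measurable_centred _ _).aemeasurable measurableSet_Ici]
        exact ae_of_all _ fun x => neg_one_le_centred _ _ x)
      (fun q hq => by
        rw [hν, memLp_map_measure_iff aestronglyMeasurable_id (measurable_centred _ _).aemeasurable]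
        exact memLp_centred (k := 3) three_ne_zero
          (by exact_mod_cast (hμ q hq (3 * β) (by positivity)).2))
      (fun q hq => by
        rw [hν, integral_map (measurable_centred _ _).aemeasurable (by fun_prop)]
        exact integral_centred (hμβ q hq).1 (hμβ q hq).2)
      (fun n (e : Edge A (N n)) => blocks e) (fun n e => blocks_mem e) P
      (fun n => iIndepFun_centred (μ := μ) (β := β) (hw_indep n))
      (fun n e => hasLaw_centred (hw_law n) e) hc0 hclim
      (fun q hq => by
        simp_rw [card_filter_blocks_eq]
        exact hKc q hq) t
    convert key using 2
    rw [charFun_gaussianReal, Finset.sum_congr rfl fun q hq => by rw [hint q hq]]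
    congr 1
    have h2s : ∑ q ∈ A, 2 * γ q * u q = 2 * s := by
      rw [hs, Finset.mul_sum]
      exact Finset.sum_congr rfl fun q _ => by ring
    rw [h2s, Real.coe_toNNReal _ (by positivity)]
    push_cast
    -- The exponents agree because `it(it - 1)/2 · 2s = -its - t²s`.
    linear_combination (-(t : ℂ) ^ 2 * s) * Complex.I_sq
  -- `W` is close to `exp L` in mean square
  have hWL : ∀ ε > 0, Tendsto (fun n => P n {x | ε ≤ |W n x - Real.exp (L n x)|}) atTop (𝓝 0) := by
    intro ε hε
    set B : ℕ → ℝ := fun n => ∑ q ∈ A, K n q * (R ^ 2 * c n q ^ 2 * u q) with hB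
    set D : ℕ → ℝ := fun n => 2 * V n * ∑ q ∈ A, R ^ 2 * c n q ^ 2 * u q with hD
    have hBlim : Tendsto B atTop (𝓝 (∑ q ∈ A, R ^ 2 * u q * (2 * γ q))) := by
      refine tendsto_finsetSum _ fun q hq => ((hKc q hq).const_mul (R ^ 2 * u q)).congr fun n => ?_
      ring
    -- Write `V c² = (K c²)(V / K)`: the first factor converges, and the second vanishes because `K`
    -- grows at least like `V²`.
    have hDlim : Tendsto D atTop (𝓝 0) := by
      have h1 : Tendsto (fun n => ∑ q ∈ A, 2 * R ^ 2 * u q * ((K n q * c n q ^ 2) * (V n / K n q)))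
          atTop (𝓝 (∑ q ∈ A, 2 * R ^ 2 * u q * (2 * γ q * 0))) :=
        tendsto_finsetSum _ fun q hq => ((hKc q hq).mul (hVK q hq)).const_mul _
      simp only [mul_zero, Finset.sum_const_zero] at h1
      refine h1.congr' ?_
      have h2 : ∀ᶠ n in atTop, ∀ q ∈ A, 0 < K n q :=
        (Finset.eventually_all A).mpr fun q hq => (hKinf q hq).eventually_gt_atTop 0
      filter_upwards [h2] with n hn
      simp only [hD, Finset.mul_sum]
      refine Finset.sum_congr rfl fun q hq => ?_
      have := hn q hq
      field_simp
    have hlim : Tendsto (fun n => ENNReal.ofReal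
        ((((√((∑ q ∈ A, m n q : ℕ) : ℝ))⁻¹ ^ 2 + B n * D n) * Real.exp (B n)) / ε ^ 2))
        atTop (𝓝 0) := by
      have h1 := (((hδ.add (hBlim.mul hDlim)).mul
        ((Real.continuous_exp.tendsto _).comp hBlim)).div_const (ε ^ 2))
      simp only [mul_zero, add_zero, zero_mul, zero_div] at h1
      have h2 := (ENNReal.continuous_ofReal.tendsto 0).comp h1
      rw [ENNReal.ofReal_zero] at h2
      exact h2
    refine tendsto_of_tendsto_of_tendsto_of_le_of_le' tendsto_const_nhds hlim
      (Eventually.of_forall fun n => zero_le) ?_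
    -- As the centred factors are at least `-1`, `c < 1` makes every `1 + c X` positive, so `exp L`
    -- really is the product.
    have hsmall : ∀ᶠ n in atTop, ∀ q ∈ A, c n q < 1 :=
      (Finset.eventually_all A).mpr fun q hq => (hclim q hq).eventually_lt_const one_pos
    filter_upwards [hsmall] with n hn
    have hexpL : ∀ x, Real.exp (L n x)
        = ∏ e, (1 + c n (blocks e) * centred (μ (blocks e)) β (w n e x)) := by
      intro x
      rw [hL, Real.exp_sum]
      refine Finset.prod_congr rfl fun e _ => Real.exp_log ?_
      have h1 := neg_one_le_centred (μ (blocks e)) β (w n e x)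
      have h2 := hn _ (blocks_mem e)
      have h3 := hc0 n (blocks e)
      nlinarith
    obtain ⟨hi, he⟩ := integrable_and_integral_sq_sub_prod hβ hμ (hw_law n) (hw_indep n)
      (inclProb (S n)) (fun e => c n (blocks e))
    have hbound := sum_sq_inclProb_sub_prod_le (hext n) hρ₁ hρ₂ h1R hR₁ hR₂
      (inv_nonneg.mpr (Real.sqrt_nonneg ((∑ q ∈ A, m n q : ℕ) : ℝ)))
      (fun Γ hΓ => by simpa only [div_eq_mul_inv] using hmatch n Γ hΓ) (hnonmatch n) (hc n) hu
    rw [← he] at hbound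
    have hmarkov := mul_meas_ge_le_integral_of_nonneg (μ := P n)
      (ae_of_all _ fun x => sq_nonneg _) hi (ε ^ 2)
    have hset : {x | ε ≤ |W n x - Real.exp (L n x)|} = {x | ε ^ 2 ≤
        (∑ Γ, inclProb (S n) Γ * ∏ e ∈ Γ, centred (μ (blocks e)) β (w n e x)
        - ∏ e, (1 + c n (blocks e) * centred (μ (blocks e)) β (w n e x))) ^ 2} := by
      ext x
      simp only [Set.mem_ofPred_eq, ← hexpL]
      rw [← sq_abs (_ - _)]
      exact (pow_le_pow_iff_left₀ hε.le (abs_nonneg _) two_ne_zero).symm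
    rw [hset, ← ENNReal.ofReal_toReal (measure_ne_top (P n) _)]
    refine ENNReal.ofReal_le_ofReal ?_
    rw [le_div_iff₀ (by positivity), mul_comm]
    exact hmarkov.trans hbound
  have hcont : ContinuousAt (charFun (gaussianReal (-s) (Real.toNNReal (2 * s)))) 0 :=
    continuous_charFun.continuousAt
  have hlog := fun ε (hε : 0 < ε) =>
    tendsto_measure_nonpos_or_le_abs_log_sub hLm hcont hLchar hWL hε
  -- the partition function is a multiple of `W`
  have hbot : ∀ n, ∀ᵐ x ∂P n, ∀ e, w n e x ≠ ⊥ := fun n =>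
    ae_forall_ne_bot hβ (fun q hq => (hμβ q hq).2) (hw_law n)
  set U : ∀ n, Ω n → ℝ := fun n x => Real.log (partitionFn (S n) (fun e => w n e x) β).toReal
        - ∑ q ∈ A, (m n q : ℝ) * psi (μ q) β with hU
  have hUW : ∀ n, ∀ᵐ x ∂P n, U n x
      = Real.log (Real.exp (∑ q ∈ A, (m n q : ℝ) * psi (μ q) β) * W n x)
        - ∑ q ∈ A, (m n q : ℝ) * psi (μ q) β := fun n => by
    filter_upwards [hbot n] with x hx
    rw [hU, hW]
    simp only
    rw [toReal_partitionFn_eq_exp_mul (hm n) hβ hμβ hx]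
  have hUm : ∀ n, AEMeasurable (U n) (P n) := fun n =>
    ((Real.measurable_log.comp_aemeasurable ((hWm n).const_mul _)).sub_const _).congr
      ((hUW n).mono fun x hx => hx.symm)
  have hUL : ∀ ε > 0, Tendsto (fun n => P n {x | ε ≤ |U n x - L n x|}) atTop (𝓝 0) := by
    intro ε hε
    refine tendsto_of_tendsto_of_tendsto_of_le_of_le tendsto_const_nhds (hlog ε hε)
      (fun n => zero_le) fun n => measure_mono_ae ?_
    filter_upwards [hUW n] with x hx hxε
    by_cases hpos : W n x ≤ 0
    · exact Or.inl hpos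
    · right
      change ε ≤ |U n x - L n x| at hxε
      rwa [hx, Real.log_mul (Real.exp_pos _).ne' (not_le.mp hpos).ne', Real.log_exp,
        add_sub_cancel_left] at hxε
  refine ⟨?_, hUm, by fun_prop, ?_⟩
  · refine tendsto_of_tendsto_of_tendsto_of_le_of_le tendsto_const_nhds (hlog 1 one_pos)
      (fun n => zero_le) fun n => measure_mono_ae ?_
    -- If `Z = 0` then `W = 0`, so this event lies in one whose probability already tends to zero.
    filter_upwards [hbot n] with x hx hx0
    left
    change partitionFn (S n) (fun e => w n e x) β = 0 at hx0
    have h1 := toReal_partitionFn_eq_exp_mul (hm n) hβ hμβ hx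
    rw [hx0, ENNReal.toReal_zero] at h1
    exact ((mul_eq_zero.mp h1.symm).resolve_left (Real.exp_pos _).ne').le
  · refine ProbabilityMeasure.tendsto_of_tendsto_charFun fun t => ?_
    have := tendsto_charFun_of_tendsto_measure_abs_sub hLm hUm hUL (hLchar t)
    simpa only [ProbabilityMeasure.coe_mk, Measure.map_id'] using this
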